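/- **Conventions.** All simplicial complexes are finite, and a complex "on $V$" has vertex set exactly $V$. A *PL sphere* is a complex stellar equivalent to the boundary of a simplex $\partial\Delta^{n}$, $n\ge 1$, i.e. related to it by finitely many isomorphisms, stellar subdivisions and inverse stellar subdivisions (equivalently, its realization is PL homeomorphic to $\partial\Delta^n$). The *wedge* of $L$ at a vertex $v$ is $\mathrm{wed}_v(L)=(I*\mathrm{lk}_L(v))\cup(\partial I*(L\setminus v))$, where $I$ is a $1$-simplex on two new vertices $v_1,v_2$. A *seed* is a PL sphere that is not isomorphic to a wedge of another PL sphere. An $(n-1)$-dimensional PL sphere $K$ on $[m]$ is *colorable* if the largest rank of a subgroup of $\mathbb Z_2^m$ acting freely on the real moment-angle complex $\mathbb R\mathcal Z_K$ is $m-n$. For a tuple $J=(j_1,\dots,j_m)$ of positive integers, $K(J)$ is the complex obtained from $K$ by $j_i-1$ wedges at $i$ or its copies, for each $i$; equivalently, its minimal non-faces are obtained from those of $K$ by replacing each vertex $i$ by its $j_i$ copies. A *mod $2$ characteristic map* over an $(n-1)$-dimensional complex $L$ on $V$ is a map $\lambda\colon V\to\mathbb Z_2^n$ that sends the vertices of every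 simplex of $L$ to linearly independent vectors. Write $\lambda$ as a matrix with columns $\lambda(v)$. A *dual map* $\overline\lambda\colon V\to\mathbb Z_2^{|V|-n}$ is given by the rows of a matrix whose columns form a basis of $\ker\lambda$. It is *quasi-injective* over $L$ if, for $v\ne w$, $\overline\lambda(v)=\overline\lambda(w)$ implies that $\{v,w\}$ is a suspended pair of $L$, i.e. $L=\partial I*L'$ with $I$ the $1$-simplex on $v,w$ and $L'$ a complex on the remaining vertices (possibly $L'=\{\varnothing\}$). Two characteristic maps are *D-J equivalent* if they differ by a linear automorphism of the target. The *canonical extension* of $\lambda$ at $v$ is the mod $2$ characteristic map $\Lambda$ over $\mathrm{wed}_v(L)$, unique up to D-J equivalence, such that the projections of $\Lambda$ modulo $\Lambda(v_1)$ (with $v_2$ identified with $v$) and modulo $\Lambda(v_2)$ (with $v_1$ identified with $v$) are both D-J equivalent to $\lambda$. **Proposition 4.6.** Let $K$ be a colorable seed on $[m]$, let $$\mathcal X_K=\{(L,\lambda)\mid L\cong K(J)\text{ for some positive integer tuple }J,\ \lambda\text{ is a mod }2\text{ characteristic map over }L\},$$ and let $\mathcal P$ be a property of pairs $(L,\lambda)$.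 Suppose that: 1. (Basis step) every $(L,\lambda)\in\mathcal X_K$ with a quasi-injective dual map $\overline\lambda$ over $L$ satisfies $\mathcal P$; 2. (Inductive step) whenever $(L,\lambda)\in\mathcal X_K$ satisfies $\mathcal P$ and $v$ is a vertex of $L$, every pair consisting of the wedge of $L$ at $v$ (with any naming of its vertices) and a representative of the canonical extension of $\lambda$ at $v$ (which is defined only up to D-J equivalence) satisfies $\mathcal P$. Then every pair in $\mathcal X_K$ satisfies $\mathcal P$. -/

import Mathlib

noncomputable section

namespace ToricWedge

open scoped Classical

/-! ### Simplicial complexes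

Mathlib's `AbstractSimplicialComplex V` has vertex set `V` (there are no ghost vertices) and stores
the nonempty simplices in `faces`. -/

/-- `s` is a simplex of `K`; the empty set is always a simplex. -/
def IsSimplex {V : Type} (K : AbstractSimplicialComplex V) (s : Finset V) : Prop :=
  s = ∅ ∨ s ∈ K.faces

/-- The complex whose nonempty simplices are the nonempty members of a family closed under passing
to subsets and containing all singletons. -/
def ofFamily {V : Type} (S : Set (Finset V)) (down : ∀ s ∈ S, ∀ t ⊆ s, t ∈ S)
    (single : ∀ v, {v} ∈ S) : AbstractSimplicialComplex V where
  faces := {s | s.Nonempty ∧ s ∈ S}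
  isRelLowerSet_faces := fun s hs => ⟨hs.1, fun t hts ht => ⟨ht, down s hs.2 t hts⟩⟩
  singleton_mem := fun v => ⟨Finset.singleton_nonempty v, single v⟩

theorem isSimplex_mono {V : Type} {K : AbstractSimplicialComplex V} {s t : Finset V}
    (hs : IsSimplex K s) (hts : t ⊆ s) : IsSimplex K t := by
  rcases t.eq_empty_or_nonempty with h | h
  · exact Or.inl h
  · rcases hs with hs | hs
    · subst hs
      exact Or.inl (Finset.subset_empty.mp hts)
    · exact Or.inr ((K.isRelLowerSet_faces hs).2 hts h)

theorem isSimplex_singleton {V : Type} (K : AbstractSimplicialComplex V) (v : V) :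
    IsSimplex K {v} :=
  Or.inr (K.singleton_mem v)

/-- The bijection `e` of vertex sets is an isomorphism of simplicial complexes. -/
def IsIso {V W : Type} (K : AbstractSimplicialComplex V) (L : AbstractSimplicialComplex W)
    (e : V ≃ W) : Prop :=
  ∀ s : Finset V, IsSimplex K s ↔ IsSimplex L (s.map e.toEmbedding)

/-- `K` has dimension `n - 1`: its largest simplices have exactly `n` vertices. -/
def HasDimSubOne {V : Type} (K : AbstractSimplicialComplex V) (n : ℕ) : Prop :=
  IsGreatest {k : ℕ | ∃ s : Finset V, IsSimplex K s ∧ s.card = k} n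

/-- The link of `σ`: all `τ` disjoint from `σ` with `σ ∪ τ` a simplex. -/
def link {V : Type} (K : AbstractSimplicialComplex V) (σ : Finset V) : Set (Finset V) :=
  {τ | IsSimplex K (σ ∪ τ) ∧ Disjoint σ τ}

/-- The deletion of `σ`: all simplices not containing `σ`. -/
def deletion {V : Type} (K : AbstractSimplicialComplex V) (σ : Finset V) : Set (Finset V) :=
  {τ | IsSimplex K τ ∧ ¬ σ ⊆ τ}

/-- The wedge of `K` at `v`, namely `(I * lk v) ∪ (∂I * (K \ v))`, where `I` is the 1-simplex on the
two copies `v₁ = some v` and `v₂ = none` of `v`; a vertex `u ≠ v` is written `some u`. The set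
`(eraseNone s).erase v` consists of the vertices of `s` outside `I`. -/
def wedge {V : Type} (K : AbstractSimplicialComplex V) (v : V) :
    AbstractSimplicialComplex (Option V) :=
  ofFamily
    {s | (Finset.eraseNone s).erase v ∈ link K {v} ∨
      ((Finset.eraseNone s).erase v ∈ deletion K {v} ∧ ¬ (some v ∈ s ∧ none ∈ s))}
    (by
      intro s hs t hts
      have h : (Finset.eraseNone t).erase v ⊆ (Finset.eraseNone s).erase v :=
        Finset.erase_subset_erase _ (Finset.eraseNone.monotone hts)
      rcases hs with ⟨hs, hd⟩ | ⟨⟨hs, -⟩, hn⟩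
      · exact Or.inl ⟨isSimplex_mono hs (Finset.union_subset_union_right h), by simp⟩
      · exact Or.inr ⟨⟨isSimplex_mono hs h, by simp⟩, fun hh => hn ⟨hts hh.1, hts hh.2⟩⟩)
    (by
      intro u
      cases u with
      | none =>
        left
        refine ⟨isSimplex_mono (isSimplex_singleton K v) ?_, by simp⟩
        intro x hx
        simpa using hx
      | some u =>
        right
        refine ⟨⟨isSimplex_mono (isSimplex_singleton K u) ?_, by simp⟩, by simp⟩
        intro x hx
        simp at hx ⊢
        exact hx.2)

/-- `{v, w}` is a suspended pair of `K`: `K` is the join `∂I * L`, where `I` is the 1-simplex on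
`v ≠ w` and `L` is a simplicial complex on the other vertices. -/
def IsSuspendedPair {V : Type} (K : AbstractSimplicialComplex V) (v w : V) : Prop :=
  v ≠ w ∧ ∃ L : AbstractSimplicialComplex {u : V // u ≠ v ∧ u ≠ w},
    ∀ s : Finset V, IsSimplex K s ↔
      ¬ (v ∈ s ∧ w ∈ s) ∧ IsSimplex L (s.subtype (fun u => u ≠ v ∧ u ≠ w))

/-- The `J`-construction `K(J)`. The vertex `i` is replaced by copies `(i, 0), …, (i, J i - 1)`, and
the minimal non-faces of `K(J)` arise from those of `K` by replacing each vertex by all its copies;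
that is, `s` is a simplex of `K(J)` iff the vertices all of whose copies lie in `s` form a simplex
of `K`. -/
def jConstruction {V : Type} [Fintype V] (K : AbstractSimplicialComplex V) (J : V → ℕ+) :
    AbstractSimplicialComplex (Σ i : V, Fin (J i)) :=
  ofFamily {s | IsSimplex K (Finset.univ.filter fun i => ∀ k : Fin (J i), ⟨i, k⟩ ∈ s)}
    (by
      intro s hs t hts
      refine isSimplex_mono hs ?_
      intro i hi
      simp only [Finset.mem_filter, Finset.mem_univ, true_and] at hi ⊢
      exact fun k => hts (hi k))
    (by
      rintro ⟨i, k⟩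
      refine isSimplex_mono (isSimplex_singleton K i) ?_
      intro j hj
      simp only [Finset.mem_filter, Finset.mem_univ, true_and, Finset.mem_singleton] at hj ⊢
      exact congrArg Sigma.fst (hj ⟨0, (J j).pos⟩))

/-! ### PL spheres and seeds -/

/-- The boundary of the `(d + 1)`-simplex, a sphere of dimension `d`. -/
def simplexBoundary (d : ℕ) : AbstractSimplicialComplex (Fin (d + 2)) :=
  ofFamily {s | s ≠ Finset.univ}
    (by
      intro s hs t hts h
      subst h
      exact hs (Finset.univ_subset_iff.mp hts))
    (by
      intro v h
      have := congrArg Finset.card h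
      simp at this)

/-- The stellar subdivision of `K` at a simplex `σ` of positive dimension, with new vertex
`a = none`: the simplices containing `σ` are removed and `a * ∂σ * lk σ` is added. (Starring at a
vertex would only rename it.) -/
def stellarSubdivision {V : Type} (K : AbstractSimplicialComplex V) (σ : Finset V)
    (hσ : IsSimplex K σ) (hcard : 2 ≤ σ.card) : AbstractSimplicialComplex (Option V) :=
  ofFamily
    {s | IsSimplex K (Finset.eraseNone s) ∧ ¬ σ ⊆ Finset.eraseNone s ∧
      (none ∈ s → IsSimplex K (σ ∪ Finset.eraseNone s))}
    (by
      intro s hs t hts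
      have h := Finset.eraseNone.monotone hts
      exact ⟨isSimplex_mono hs.1 h, fun hc => hs.2.1 (hc.trans h), fun hn =>
        isSimplex_mono (hs.2.2 (hts hn)) (Finset.union_subset_union_right h)⟩)
    (by
      intro u
      cases u with
      | none =>
        have h : Finset.eraseNone ({none} : Finset (Option V)) = ∅ := by ext x; simp
        simp only [Set.mem_ofPred_eq, h]
        refine ⟨Or.inl rfl, fun hc => ?_, fun _ => by simpa using hσ⟩
        have := Finset.card_le_card hc
        rw [Finset.card_empty] at this
        omega
      | some u =>
        have h : Finset.eraseNone ({some u} : Finset (Option V)) = {u} := by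
          ext x; simp
        simp only [Set.mem_ofPred_eq, h]
        refine ⟨isSimplex_singleton K u, fun hc => ?_, by simp⟩
        have := Finset.card_le_card hc
        rw [Finset.card_singleton] at this
        omega)

/-- One elementary step: an isomorphism or a stellar subdivision. -/
inductive StellarStep :
    (Σ V : Type, AbstractSimplicialComplex V) → (Σ V : Type, AbstractSimplicialComplex V) → Prop
  | iso {V W : Type} (K : AbstractSimplicialComplex V) (L : AbstractSimplicialComplex W)
      (e : V ≃ W) (h : IsIso K L e) : StellarStep ⟨V, K⟩ ⟨W, L⟩
  | subdivide {V : Type} (K : AbstractSimplicialComplex V) (σ : Finset V) (hσ : IsSimplex K σ)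
      (hcard : 2 ≤ σ.card) : StellarStep ⟨V, K⟩ ⟨Option V, stellarSubdivision K σ hσ hcard⟩

/-- `K` is a PL sphere: it is combinatorially (stellar) equivalent to the boundary of a simplex,
that is, related to it by finitely many isomorphisms, stellar subdivisions and inverses of these.
By the Alexander–Newman theorem this says that the realization of `K` is PL homeomorphic to the
boundary of a simplex. -/
def IsPLSphere {V : Type} (K : AbstractSimplicialComplex V) : Prop :=
  ∃ d : ℕ, Relation.EqvGen StellarStep ⟨V, K⟩ ⟨Fin (d + 2), simplexBoundary d⟩

/-- A seed is a PL sphere that is not isomorphic to a wedge of another PL sphere. -/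
def IsSeed {V : Type} (K : AbstractSimplicialComplex V) : Prop :=
  IsPLSphere K ∧
    ¬ ∃ (W : Type) (L : AbstractSimplicialComplex W) (v : W) (e : Option W ≃ V),
      IsPLSphere L ∧ IsIso (wedge L v) K e

/-! ### Real Buchstaber number and colorability -/

/-- The real moment-angle complex `ℝZ_K ⊆ (D¹)^V`: points with all coordinates in `[-1, 1]` whose
coordinates outside some simplex are `±1`. -/
def realMomentAngle {V : Type} (K : AbstractSimplicialComplex V) : Set (V → ℝ) :=
  {x | (∀ i, x i ∈ Set.Icc (-1 : ℝ) 1) ∧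
    ∃ s : Finset V, IsSimplex K s ∧ ∀ i ∉ s, x i = 1 ∨ x i = -1}

/-- The coordinatewise action of `ℤ₂^V` by changes of sign. -/
def signAct {V : Type} (g : V → ZMod 2) (x : V → ℝ) : V → ℝ :=
  fun i => if g i = 0 then x i else - x i

/-- The subgroup `H` of `ℤ₂^V` acts freely on `ℝZ_K`. -/
def ActsFreely {V : Type} (K : AbstractSimplicialComplex V)
    (H : Submodule (ZMod 2) (V → ZMod 2)) : Prop :=
  ∀ g ∈ H, ∀ x ∈ realMomentAngle K, signAct g x = x → g = 0

/-- The real Buchstaber number of `K` (on a finite vertex set): the largest rank of a subgroup of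
`ℤ₂^V` acting freely on `ℝZ_K`. -/
def realBuchstaberNumber {V : Type} (K : AbstractSimplicialComplex V) : ℕ :=
  sSup {r : ℕ | ∃ H : Submodule (ZMod 2) (V → ZMod 2),
    Module.finrank (ZMod 2) H = r ∧ ActsFreely K H}

/-- `K`, of dimension `n - 1` with `m` vertices, is colorable: its real Buchstaber number equals its
Picard number `m - n`. -/
def IsColorable {V : Type} (K : AbstractSimplicialComplex V) : Prop :=
  ∃ n : ℕ, HasDimSubOne K n ∧ (realBuchstaberNumber K : ℤ) = (Nat.card V : ℤ) - n

/-! ### Mod 2 characteristic maps and their duals -/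

/-- `lam` is a mod 2 characteristic map over the `(n - 1)`-dimensional complex `L`: the values at
the vertices of any simplex are linearly independent (unimodular). -/
def IsCharMap {V : Type} {n : ℕ} (L : AbstractSimplicialComplex V)
    (lam : V → Fin n → ZMod 2) : Prop :=
  HasDimSubOne L n ∧ ∀ s : Finset V, IsSimplex L s → LinearIndepOn (ZMod 2) lam (s : Set V)

/-- A pair `(L, λ)` of a finite simplicial complex `L` and a mod 2 characteristic map `λ` over it. -/
structure CharPair where
  V : Type
  [fintypeV : Fintype V]
  L : AbstractSimplicialComplex V
  n : ℕ
  lam : V → Fin n → ZMod 2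
  isCharMap : IsCharMap L lam

attribute [instance] CharPair.fintypeV

/-- `mu` is a dual of `lam`: regarding `lam` as the matrix with columns `lam v` and `mu` as the
matrix with rows `mu v`, the columns of `mu` form a basis of the kernel of `lam`. -/
def IsDual {V : Type} [Fintype V] {n p : ℕ} (lam : V → Fin n → ZMod 2)
    (mu : V → Fin p → ZMod 2) : Prop :=
  LinearIndependent (ZMod 2) (fun (j : Fin p) (v : V) => mu v j) ∧
    Submodule.span (ZMod 2) (Set.range fun (j : Fin p) (v : V) => mu v j) =
      LinearMap.ker (Fintype.linearCombination (ZMod 2) lam)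

/-- `mu` is quasi-injective over `L`: only suspended pairs of `L` may have equal values. -/
def IsQuasiInjective {V : Type} {p : ℕ} (L : AbstractSimplicialComplex V)
    (mu : V → Fin p → ZMod 2) : Prop :=
  ∀ v w : V, v ≠ w → mu v = mu w → IsSuspendedPair L v w

/-- The set `X_K` of all pairs `(L, λ)` with `L = K(J)` for some positive integer tuple `J` (up to
the names of the vertices) and `λ` a mod 2 characteristic map over `L`. -/
def pairsOver {V : Type} [Fintype V] (K : AbstractSimplicialComplex V) : Set CharPair :=
  {X | ∃ (J : V → ℕ+) (e : (Σ i : V, Fin (J i)) ≃ X.V), IsIso (jConstruction K J) X.L e}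

/-! ### Canonical extensions -/

/-- Davis–Januszkiewicz equivalence: two maps differ by a linear isomorphism of the targets. -/
def DJEquiv {V E F : Type} [AddCommGroup E] [Module (ZMod 2) E] [AddCommGroup F]
    [Module (ZMod 2) F] (f : V → E) (g : V → F) : Prop :=
  ∃ φ : E ≃ₗ[ZMod 2] F, ∀ v, φ (f v) = g v

/-- The projection with respect to a vertex `a`: the classes of the values modulo the value
at `a`. -/
def proj {W : Type} {n : ℕ} (Lam : W → Fin n → ZMod 2) (a : W) (w : W) :
    (Fin n → ZMod 2) ⧸ Submodule.span (ZMod 2) {Lam a} :=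
  Submodule.Quotient.mk (Lam w)

/-- `Lam`, on the vertices of the wedge at `v`, is `lam₁ ∧_v lam₂`: its projection with respect to
`v₁ = some v` is `lam₁`, where `v₂ = none` is identified with `v`, and its projection with respect
to `v₂` is `lam₂`, where `v₁` is identified with `v`, both up to D-J equivalence. -/
def IsWedgeMap {V : Type} {n k : ℕ} (v : V) (lam₁ lam₂ : V → Fin n → ZMod 2)
    (Lam : Option V → Fin k → ZMod 2) : Prop :=
  DJEquiv (fun u : V => proj Lam (some v) (if u = v then none else some u)) lam₁ ∧
    DJEquiv (fun u : V => proj Lam none (some u)) lam₂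

/-- `Y` is the pair consisting of the wedge of `X.L` at `v` and the canonical extension
`λ ∧_v λ` of `λ = X.lam` at `v`. The wedge is determined up to the names of its vertices and the
canonical extension up to D-J equivalence; `Y` may be any representative. -/
def IsCanonicalExtension (X : CharPair) (v : X.V) (Y : CharPair) : Prop :=
  ∃ e : Option X.V ≃ Y.V, IsIso (wedge X.L v) Y.L e ∧
    IsWedgeMap v X.lam X.lam (fun u => Y.lam (e u))

end ToricWedge

end

/-! The proof is a descent on the number of vertices of `L`. Suppose the dual of `λ` takes the same
value at vertices `v ≠ w` that are not suspended in `L`. The sum of the coordinates `v` and `w` then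
kills the kernel of `λ`, so it factors through `λ`. This gives a functional `f` that is 1 at `λ(v)`
and `λ(w)` and 0 at all other values (`IsDual.exists_functional`).

Let `π` send each vertex of `L` to the vertex of `K` it is a copy of. If `π v = π w`, then `L` is
the wedge at `v` of the link of `w`. The transvection built from `f` swaps `λ(v)` and `λ(w)` and
fixes the other values, so the two projections of `λ` are D-J equivalent. Thus `(L, λ)` is a
canonical extension of a smaller pair (`exists_isCanonicalExtension`), and the inductive step
applies.

Suppose `π v ≠ π w`. A facet of `K` missing both would give a facet of `L` missing `v` and `w`. Its
values form a basis on which `f` vanishes, which is impossible. Hence every facet of `K` contains `i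
= π v` or `j = π w` (`IsInflation.exists_extension`). Moving across ridges of the sphere then makes
`i` and `j` interchangeable (`IsPLSphere.exchange`). If `{i, j}` were an edge, `K` would be a wedge
of the link of `i`, contrary to being a seed; so `K` is a suspension with poles `i` and `j`
(`IsSeed.isSimplex_iff_of_extends`). Copies of the two poles can be redistributed without changing
`L`, which either puts `v` and `w` over one vertex or shows that they are suspended
(`IsInflation.isSuspendedPair_or_exists`).

The facts needed about PL spheres are purity and sphericity of links. Both are checked on simplex
boundaries and carried through stellar moves in either direction. Families of sets in a common
ground type are used because links and subdivisions change the vertex set. -/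

noncomputable section

namespace ToricWedge

open scoped Classical

/-! ### Families of finite sets -/

/-- All simplices of `K`, the empty one included. -/
def simplices {V : Type} (K : AbstractSimplicialComplex V) : Set (Finset V) := {s | IsSimplex K s}

/-- The image of a family of finite sets under an injection of the ground sets. -/
def famMap {V W : Type} (f : V ↪ W) (S : Set (Finset V)) : Set (Finset W) := Finset.map f '' S

/-- The link of `τ` in a family. -/
def famLink {V : Type} (S : Set (Finset V)) (τ : Finset V) : Set (Finset V) :=
  {ρ | τ ∪ ρ ∈ S ∧ Disjoint τ ρ}

/-- The stellar subdivision of a family at `σ`, with the new vertex `a` taken in the ground set. -/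
def stellarAt {V : Type} (S : Set (Finset V)) (σ : Finset V) (a : V) : Set (Finset V) :=
  {s | s.erase a ∈ S ∧ ¬ σ ⊆ s.erase a ∧ (a ∈ s → σ ∪ s.erase a ∈ S)}

/-- The join of the boundary of the simplex `A` with a family. -/
def boundaryJoin {V : Type} (A : Finset V) (T : Set (Finset V)) : Set (Finset V) :=
  {e | ¬ A ⊆ e ∧ e \ A ∈ T}

/-- A family closed under passing to subsets. -/
def IsDownClosed {V : Type} (S : Set (Finset V)) : Prop := ∀ s ∈ S, ∀ t ⊆ s, t ∈ S

/-- The family is a PL sphere on some subset of its ground set, or the `(-1)`-sphere. -/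
def IsSphereFamily {V : Type} (S : Set (Finset V)) : Prop :=
  S = {∅} ∨ ∃ (W : Type) (L : AbstractSimplicialComplex W) (f : W ↪ V),
    IsPLSphere L ∧ S = famMap f (simplices L)

theorem isSimplex_ofFamily {V : Type} {S : Set (Finset V)} {h₁ : ∀ s ∈ S, ∀ t ⊆ s, t ∈ S}
    {h₂ : ∀ v, {v} ∈ S} (h₀ : ∅ ∈ S) (s : Finset V) :
    IsSimplex (ofFamily S h₁ h₂) s ↔ s ∈ S := by
  constructor
  · rintro (rfl | h)
    · exact h₀
    · exact h.2
  · intro h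
    rcases s.eq_empty_or_nonempty with rfl | hs
    · exact Or.inl rfl
    · exact Or.inr ⟨hs, h⟩

theorem empty_mem_simplices {V : Type} (K : AbstractSimplicialComplex V) : ∅ ∈ simplices K :=
  Or.inl rfl

theorem isDownClosed_simplices {V : Type} (K : AbstractSimplicialComplex V) :
    IsDownClosed (simplices K) := fun _ hs _ hts => isSimplex_mono hs hts

theorem map_mem_famMap {V W : Type} (f : V ↪ W) (S : Set (Finset V)) (s : Finset V) :
    s.map f ∈ famMap f S ↔ s ∈ S :=
  (Finset.map_injective f).mem_set_image

theorem famMap_famMap {U V W : Type} (f : U ↪ V) (g : V ↪ W) (S : Set (Finset U)) :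
    famMap g (famMap f S) = famMap (f.trans g) S := by
  simp [famMap, Set.image_image, Finset.map_map]

theorem famMap_injective {V W : Type} (f : V ↪ W) : Function.Injective (famMap f) :=
  Set.image_injective.mpr (Finset.map_injective f)

theorem exists_map_eq {V W : Type} (f : V ↪ W) (s : Finset W) (h : ∀ x ∈ s, ∃ y, f y = x) :
    ∃ t : Finset V, t.map f = s := by
  refine ⟨s.preimage f f.injective.injOn, ?_⟩
  ext x
  simp only [Finset.mem_map, Finset.mem_preimage]
  constructor
  · rintro ⟨y, hy, rfl⟩
    exact hy
  · intro hx
    obtain ⟨y, rfl⟩ := h x hx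
    exact ⟨y, hx, rfl⟩

theorem exists_of_mem_of_mem_famMap {V W : Type} {f : V ↪ W} {S : Set (Finset V)} {s : Finset W}
    (hs : s ∈ famMap f S) {x : W} (hx : x ∈ s) : ∃ y, f y = x := by
  obtain ⟨t, -, rfl⟩ := hs
  obtain ⟨y, -, hy⟩ := Finset.mem_map.mp hx
  exact ⟨y, hy⟩

theorem IsDownClosed.famMap {V W : Type} {S : Set (Finset V)} (hS : IsDownClosed S) (f : V ↪ W) :
    IsDownClosed (famMap f S) := by
  rintro _ ⟨s, hs, rfl⟩ t ht
  obtain ⟨t, rfl⟩ := exists_map_eq f t fun x hx => by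
    obtain ⟨y, -, hy⟩ := Finset.mem_map.mp (ht hx)
    exact ⟨y, hy⟩
  exact ⟨t, hS s hs t (Finset.map_subset_map.mp ht), rfl⟩

theorem IsDownClosed.famLink {V : Type} {S : Set (Finset V)} (hS : IsDownClosed S) (τ : Finset V) :
    IsDownClosed (famLink S τ) := fun _ hs _ hts =>
  ⟨hS _ hs.1 _ (Finset.union_subset_union_right hts), hs.2.mono_right hts⟩

theorem famMap_eq_singleton_empty {V W : Type} (f : V ↪ W) (S : Set (Finset V)) :
    famMap f S = {∅} ↔ S = {∅} := by
  have h : famMap f {∅} = {∅} := by simp [famMap]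
  rw [← h]
  exact (famMap_injective f).eq_iff

theorem famMap_famLink {V W : Type} (f : V ↪ W) (S : Set (Finset V)) (τ : Finset V) :
    famLink (famMap f S) (τ.map f) = famMap f (famLink S τ) := by
  ext s
  constructor
  · intro hs
    obtain ⟨t, rfl⟩ := exists_map_eq f s fun x hx =>
      exists_of_mem_of_mem_famMap hs.1 (Finset.mem_union_right _ hx)
    rw [map_mem_famMap]
    obtain ⟨h₁, h₂⟩ := hs
    rw [← Finset.map_union, map_mem_famMap] at h₁
    exact ⟨h₁, (Finset.disjoint_map f).mp h₂⟩
  · rintro ⟨t, ⟨h₁, h₂⟩, rfl⟩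
    refine ⟨?_, (Finset.disjoint_map f).mpr h₂⟩
    rwa [← Finset.map_union, map_mem_famMap]

theorem famMap_stellarAt {V W : Type} (f : V ↪ W) (S : Set (Finset V)) (σ : Finset V) (a : V) :
    stellarAt (famMap f S) (σ.map f) (f a) = famMap f (stellarAt S σ a) := by
  have key : ∀ t : Finset V, t.map f ∈ stellarAt (famMap f S) (σ.map f) (f a) ↔
      t ∈ stellarAt S σ a := fun t => by
    simp only [stellarAt, Set.mem_ofPred_eq, ← Finset.map_erase, ← Finset.map_union,
      map_mem_famMap, Finset.map_subset_map, Finset.mem_map' f]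
  ext s
  constructor
  · intro hs
    obtain ⟨t, rfl⟩ := exists_map_eq f s fun x hx => by
      by_cases hxa : x = f a
      · exact ⟨a, hxa.symm⟩
      · exact exists_of_mem_of_mem_famMap hs.1 (Finset.mem_erase.mpr ⟨hxa, hx⟩)
    rw [map_mem_famMap]
    exact (key t).mp hs
  · rintro ⟨t, ht, rfl⟩
    exact (key t).mpr ht

theorem famMap_boundaryJoin {V W : Type} (f : V ↪ W) (A : Finset V) (T : Set (Finset V)) :
    boundaryJoin (A.map f) (famMap f T) = famMap f (boundaryJoin A T) := by
  have hmap : ∀ t : Finset V, t.map f \ A.map f = (t \ A).map f := fun t => by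
    ext x
    simp only [Finset.mem_sdiff, Finset.mem_map]
    constructor
    · rintro ⟨⟨y, hy, rfl⟩, h⟩
      exact ⟨y, ⟨hy, fun hA => h ⟨y, hA, rfl⟩⟩, rfl⟩
    · rintro ⟨y, ⟨hy, hA⟩, rfl⟩
      exact ⟨⟨y, hy, rfl⟩, fun ⟨z, hz, hzy⟩ => hA (f.injective hzy ▸ hz)⟩
  have key : ∀ t : Finset V, t.map f ∈ boundaryJoin (A.map f) (famMap f T) ↔
      t ∈ boundaryJoin A T := fun t => by
    simp only [boundaryJoin, Set.mem_ofPred_eq, hmap, map_mem_famMap, Finset.map_subset_map]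
  ext s
  constructor
  · intro hs
    obtain ⟨t, rfl⟩ := exists_map_eq f s fun x hx => by
      by_cases hxa : x ∈ A.map f
      · obtain ⟨y, -, hy⟩ := Finset.mem_map.mp hxa
        exact ⟨y, hy⟩
      · exact exists_of_mem_of_mem_famMap hs.2 (Finset.mem_sdiff.mpr ⟨hx, hxa⟩)
    rw [map_mem_famMap]
    exact (key t).mp hs
  · rintro ⟨t, ht, rfl⟩
    exact (key t).mpr ht

/-! ### Isomorphisms and stellar moves -/

theorem IsIso.simplices_eq {V W : Type} {K : AbstractSimplicialComplex V}
    {L : AbstractSimplicialComplex W} {e : V ≃ W} (h : IsIso K L e) :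
    simplices L = famMap e.toEmbedding (simplices K) := by
  ext s
  obtain ⟨t, rfl⟩ := exists_map_eq e.toEmbedding s fun x _ => ⟨e.symm x, e.apply_symm_apply x⟩
  rw [map_mem_famMap]
  exact (h t).symm

/-- Every vertex is a simplex, so the image family determines the image of the vertex set; there are
no ghost vertices to spoil the bijection. -/
theorem isIso_of_famMap_eq {U V W : Type} {K : AbstractSimplicialComplex V}
    {L : AbstractSimplicialComplex W} {f : V ↪ U} {g : W ↪ U}
    (h : famMap f (simplices K) = famMap g (simplices L)) : ∃ e : V ≃ W, IsIso K L e := by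
  have hsub : ∀ {V W : Type} {K : AbstractSimplicialComplex V} {L : AbstractSimplicialComplex W}
      {f : V ↪ U} {g : W ↪ U}, famMap f (simplices K) = famMap g (simplices L) →
      Set.range f ⊆ Set.range g := by
    rintro V W K L f g h _ ⟨v, rfl⟩
    have hv : ({v} : Finset V).map f ∈ famMap g (simplices L) := by
      rw [← h, map_mem_famMap]
      exact isSimplex_singleton K v
    exact exists_of_mem_of_mem_famMap hv (by simp)
  have hr : Set.range f = Set.range g := (hsub h).antisymm (hsub h.symm)
  let e : V ≃ W := (Equiv.ofInjective f f.injective).trans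
    ((Equiv.setCongr hr).trans (Equiv.ofInjective g g.injective).symm)
  have he : ∀ v, g (e v) = f v := fun v => by
    have := Equiv.apply_ofInjective_symm g.injective
      ((Equiv.setCongr hr) (Equiv.ofInjective f f.injective v))
    exact this
  refine ⟨e, fun s => ?_⟩
  have hs : (s.map e.toEmbedding).map g = s.map f := by
    rw [Finset.map_map]
    congr 1
    ext v
    exact he v
  change s ∈ simplices K ↔ s.map e.toEmbedding ∈ simplices L
  rw [← map_mem_famMap f, h, ← hs, map_mem_famMap]

theorem IsPLSphere.of_iso {V W : Type} {K : AbstractSimplicialComplex V}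
    {L : AbstractSimplicialComplex W} {e : V ≃ W} (h : IsIso K L e) (hK : IsPLSphere K) :
    IsPLSphere L := by
  obtain ⟨d, hd⟩ := hK
  exact ⟨d, ((Relation.EqvGen.rel _ _ (StellarStep.iso K L e h)).symm).trans _ _ _ hd⟩

theorem isPLSphere_stellarSubdivision_iff {V : Type} {K : AbstractSimplicialComplex V}
    {σ : Finset V} (hσ : IsSimplex K σ) (hcard : 2 ≤ σ.card) :
    IsPLSphere (stellarSubdivision K σ hσ hcard) ↔ IsPLSphere K := by
  have h := Relation.EqvGen.rel _ _ (StellarStep.subdivide K σ hσ hcard)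
  exact ⟨fun ⟨d, hd⟩ => ⟨d, h.trans _ _ _ hd⟩, fun ⟨d, hd⟩ => ⟨d, (h.symm).trans _ _ _ hd⟩⟩

/-- The family `{∅}` is set apart because it counts as the `(-1)`-sphere by convention, outside the
definition of `IsPLSphere`. -/
theorem isSphereFamily_famMap_simplices_iff {V W : Type} (L : AbstractSimplicialComplex W)
    (f : W ↪ V) (h : simplices L ≠ {∅}) :
    IsSphereFamily (famMap f (simplices L)) ↔ IsPLSphere L := by
  constructor
  · rintro (h' | ⟨W', L', f', hL', h'⟩)
    · exact absurd ((famMap_eq_singleton_empty f _).mp h') h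
    · obtain ⟨e, he⟩ := isIso_of_famMap_eq h'.symm
      exact hL'.of_iso he
  · exact fun hL => Or.inr ⟨W, L, f, hL, rfl⟩

theorem exists_eq_famMap_simplices {V : Type} {S : Set (Finset V)} (hS : IsDownClosed S)
    (h₀ : ∅ ∈ S) :
    ∃ (W : Type) (L : AbstractSimplicialComplex W) (f : W ↪ V), S = famMap f (simplices L) := by
  let f : {v : V // ({v} : Finset V) ∈ S} ↪ V := Function.Embedding.subtype _
  have hdown : IsDownClosed {s : Finset {v : V // ({v} : Finset V) ∈ S} | s.map f ∈ S} :=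
    fun s hs t hts => hS _ hs _ (Finset.map_subset_map.mpr hts)
  have hsingle : ∀ v : {v : V // ({v} : Finset V) ∈ S}, ({v} : Finset _).map f ∈ S := fun v => by
    simpa [f] using v.2
  refine ⟨_, ofFamily {s | s.map f ∈ S} hdown hsingle, f, ?_⟩
  have hsimp : simplices (ofFamily {s | s.map f ∈ S} hdown hsingle) = {s | s.map f ∈ S} :=
    Set.ext fun s => isSimplex_ofFamily (by simpa using h₀) s
  rw [hsimp]
  ext s
  constructor
  · intro hs
    obtain ⟨t, rfl⟩ := exists_map_eq f s fun x hx =>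
      ⟨⟨x, hS s hs {x} (Finset.singleton_subset_iff.mpr hx)⟩, rfl⟩
    exact ⟨t, hs, rfl⟩
  · rintro ⟨t, ht, rfl⟩
    exact ht

theorem isSphereFamily_famMap_iff {V W : Type} (f : V ↪ W) {S : Set (Finset V)}
    (hS : IsDownClosed S) (h₀ : ∅ ∈ S) : IsSphereFamily (famMap f S) ↔ IsSphereFamily S := by
  obtain ⟨U, L, g, rfl⟩ := exists_eq_famMap_simplices hS h₀
  by_cases h : simplices L = {∅}
  · have h' : ∀ {X : Type} (k : U ↪ X), IsSphereFamily (famMap k (simplices L)) := fun k =>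
      Or.inl ((famMap_eq_singleton_empty k _).mpr h)
    rw [famMap_famMap]
    exact iff_of_true (h' _) (h' _)
  · rw [famMap_famMap, isSphereFamily_famMap_simplices_iff _ _ h,
      isSphereFamily_famMap_simplices_iff _ _ h]

theorem simplices_stellarSubdivision {V : Type} {K : AbstractSimplicialComplex V}
    {σ : Finset V} (hσ : IsSimplex K σ) (hcard : 2 ≤ σ.card) :
    simplices (stellarSubdivision K σ hσ hcard) =
      stellarAt (famMap Function.Embedding.some (simplices K))
        (σ.map Function.Embedding.some) none := by
  have hne : ¬ σ ⊆ ∅ := fun h => by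
    have := Finset.card_le_card h
    rw [Finset.card_empty] at this
    omega
  ext s
  refine (isSimplex_ofFamily ?_ s).trans ?_
  · have h : Finset.eraseNone (∅ : Finset (Option V)) = ∅ := by ext x; simp
    simp only [Set.mem_ofPred_eq, h]
    exact ⟨Or.inl rfl, hne, by simp⟩
  · have h : @Finset.erase _ (fun a b => Classical.propDecidable (a = b)) s none =
        (Finset.eraseNone s).map Function.Embedding.some := by
      ext x
      cases x <;> simp
    simp only [stellarAt, Set.mem_ofPred_eq, h, map_mem_famMap, ← Finset.map_union,
      Finset.map_subset_map]
    rfl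

/-- Starring at a vertex merely renames it. The case has to be covered because passing to the link
of `τ` turns a subdivision at `σ` into one at `σ \ τ`, which may be a single vertex. -/
theorem stellarAt_singleton {V : Type} {S : Set (Finset V)} (hS : IsDownClosed S) (x a : V)
    (ha : ∀ s ∈ S, a ∉ s) :
    stellarAt S {x} a = famMap (Equiv.swap x a).toEmbedding S := by
  have key : ∀ t : Finset V, t.map (Equiv.swap x a).toEmbedding ∈ stellarAt S {x} a ↔ t ∈ S := by
    intro t
    by_cases hxa : x = a
    · subst hxa
      have : t.map (Equiv.swap x x).toEmbedding = t := by
        ext; simp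
      rw [this]
      simp only [stellarAt, Set.mem_ofPred_eq, Finset.singleton_subset_iff, Finset.mem_erase,
        ne_eq, not_true, false_and, not_false_eq_true, true_and]
      by_cases hxt : x ∈ t
      · refine iff_of_false (fun h => ha _ (h.2 hxt) (by simp)) (fun h => ha _ h hxt)
      · rw [Finset.erase_eq_of_notMem hxt]
        simp [hxt]
    have hmem : ∀ y, y ∈ t.map (Equiv.swap x a).toEmbedding ↔ Equiv.swap x a y ∈ t := by
      intro y
      rw [Finset.mem_map_equiv, Equiv.symm_swap]
    by_cases hat : a ∈ t
    · refine iff_of_false (fun h => h.2.1 ?_) (fun h => ha _ h hat)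
      rw [Finset.singleton_subset_iff, Finset.mem_erase, hmem, Equiv.swap_apply_left]
      exact ⟨hxa, hat⟩
    have herase : (t.map (Equiv.swap x a).toEmbedding).erase a = t.erase x := by
      ext y
      rw [Finset.mem_erase, hmem, Finset.mem_erase]
      by_cases hyx : y = x
      · subst hyx
        simp [hat]
      · by_cases hya : y = a
        · subst hya
          simp [hat]
        · rw [Equiv.swap_apply_of_ne_of_ne hyx hya]
          simp [hyx, hya]
    simp only [stellarAt, Set.mem_ofPred_eq, herase, hmem, Equiv.swap_apply_right]
    by_cases hxt : x ∈ t
    · have hx : {x} ∪ t.erase x = t := by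
        rw [← Finset.insert_eq, Finset.insert_erase hxt]
      rw [hx]
      exact ⟨fun h => h.2.2 hxt, fun h => ⟨hS _ h _ (Finset.erase_subset _ _), by simp, fun _ => h⟩⟩
    · rw [Finset.erase_eq_of_notMem hxt]
      simp [hxt]
  ext s
  obtain ⟨t, rfl⟩ := exists_map_eq (Equiv.swap x a).toEmbedding s
    fun y _ => ⟨Equiv.swap x a y, by simp⟩
  rw [key, map_mem_famMap]

theorem isSphereFamily_stellarAt_iff {V : Type} {S : Set (Finset V)} (hS : IsDownClosed S)
    {σ : Finset V} (hσ : σ ∈ S) (hne : σ.Nonempty) {a : V} (ha : ∀ s ∈ S, a ∉ s) :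
    IsSphereFamily (stellarAt S σ a) ↔ IsSphereFamily S := by
  have h₀ : ∅ ∈ S := hS _ hσ _ (by simp)
  by_cases hcard : 2 ≤ σ.card
  · obtain ⟨W, L, f, rfl⟩ := exists_eq_famMap_simplices hS h₀
    obtain ⟨σ, hmem, rfl⟩ := hσ
    have hσ : IsSimplex L σ := hmem
    rw [Finset.card_map] at hcard
    have hfa : ∀ w, f w ≠ a := fun w hw =>
      ha _ ⟨{w}, isSimplex_singleton L w, rfl⟩ (by simp [hw])
    let g : Option W ↪ V := ⟨fun o => o.elim a f, by
      rintro (_ | u) (_ | w) h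
      · rfl
      · exact absurd h.symm (hfa w)
      · exact absurd h (hfa u)
      · exact congrArg some (f.injective h)⟩
    have hg : Function.Embedding.some.trans g = f := rfl
    have hst : stellarAt (famMap f (simplices L)) (σ.map f) a =
        famMap g (simplices (stellarSubdivision L σ hσ hcard)) := by
      rw [simplices_stellarSubdivision, ← famMap_stellarAt, famMap_famMap, Finset.map_map, hg]
      rfl
    rw [hst, isSphereFamily_famMap_simplices_iff, isSphereFamily_famMap_simplices_iff,
      isPLSphere_stellarSubdivision_iff]
    · intro h
      rw [h, Set.mem_singleton_iff] at hmem
      simp [hmem] at hcard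
    · intro h
      have : {none} ∈ simplices (stellarSubdivision L σ hσ hcard) := isSimplex_singleton _ _
      rw [h] at this
      simp at this
  · obtain ⟨x, rfl⟩ := Finset.card_eq_one.mp (by have := hne.card_pos; omega : σ.card = 1)
    rw [stellarAt_singleton hS x a ha, isSphereFamily_famMap_iff _ hS h₀]

theorem simplices_simplexBoundary (d : ℕ) :
    simplices (simplexBoundary d) = {s | s ≠ Finset.univ} := by
  ext s
  refine isSimplex_ofFamily ?_ s
  intro h
  have := congrArg Finset.card h
  simp at this

theorem isPLSphere_simplexBoundary (d : ℕ) : IsPLSphere (simplexBoundary d) :=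
  ⟨d, Relation.EqvGen.refl _⟩

/-- Induction on PL spheres, for properties of families of finite sets. -/
theorem IsPLSphere.family_induction {Q : ∀ {V : Type}, Set (Finset V) → Prop}
    (base : ∀ d, Q {s : Finset (Fin (d + 2)) | s ≠ Finset.univ})
    (iso : ∀ {V W : Type} (e : V ≃ W) (S : Set (Finset V)), IsDownClosed S → ∅ ∈ S → Q S →
      Q (famMap e.toEmbedding S))
    (stellar : ∀ {V : Type} (S : Set (Finset V)) (σ : Finset V), IsDownClosed S → σ ∈ S →
      2 ≤ σ.card → (Q (stellarAt (famMap Function.Embedding.some S)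
        (σ.map Function.Embedding.some) none) ↔ Q S))
    {V : Type} {K : AbstractSimplicialComplex V} (hK : IsPLSphere K) : Q (simplices K) := by
  obtain ⟨d, hd⟩ := hK
  have main : ∀ X Y : Σ V : Type, AbstractSimplicialComplex V, Relation.EqvGen StellarStep X Y →
      (Q (simplices X.2) ↔ Q (simplices Y.2)) := by
    intro X Y h
    induction h with
    | rel X Y h =>
      cases h with
      | iso K L e h =>
        have hsymm : simplices K = famMap e.symm.toEmbedding (simplices L) := by
          rw [h.simplices_eq, famMap_famMap]
          have : e.toEmbedding.trans e.symm.toEmbedding = Function.Embedding.refl _ := by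
            ext; simp
          rw [this]
          simp [famMap]
        constructor
        · intro hq
          rw [h.simplices_eq]
          exact iso e _ (isDownClosed_simplices K) (empty_mem_simplices K) hq
        · intro hq
          rw [hsymm]
          exact iso e.symm _ (isDownClosed_simplices L) (empty_mem_simplices L) hq
      | subdivide K σ hσ hcard =>
        rw [simplices_stellarSubdivision]
        exact (stellar _ σ (isDownClosed_simplices K) hσ hcard).symm
    | refl X => exact Iff.rfl
    | symm X Y _ ih => exact ih.symm
    | trans X Y Z _ _ ih₁ ih₂ => exact ih₁.trans ih₂
  refine (main _ _ hd).mpr ?_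
  rw [simplices_simplexBoundary]
  exact base d

/-! ### Joins with the boundary of a simplex -/

theorem isSphereFamily_ssubsets {V : Type} {A : Finset V} (hA : A.Nonempty) :
    IsSphereFamily {e | e ⊂ A} := by
  by_cases hcard : A.card = 1
  · obtain ⟨x, rfl⟩ := Finset.card_eq_one.mp hcard
    left
    ext e
    simp [Finset.ssubset_singleton_iff]
  · obtain ⟨d, hd⟩ : ∃ d, A.card = d + 2 := ⟨A.card - 2, by have := hA.card_pos; omega⟩
    let f : Fin (d + 2) ↪ V :=
      (A.equivFinOfCardEq hd).symm.toEmbedding.trans (Function.Embedding.subtype _)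
    have hf : Finset.univ.map f = A := by
      ext x
      simp only [Finset.mem_map, Finset.mem_univ, true_and]
      constructor
      · rintro ⟨y, rfl⟩
        exact ((A.equivFinOfCardEq hd).symm y).2
      · intro hx
        exact ⟨A.equivFinOfCardEq hd ⟨x, hx⟩, by simp [f]⟩
    refine Or.inr ⟨_, simplexBoundary d, f, isPLSphere_simplexBoundary d, ?_⟩
    rw [simplices_simplexBoundary]
    ext e
    constructor
    · intro he
      obtain ⟨t, rfl⟩ := exists_map_eq f e fun x hx => by
        have := he.1 hx
        rw [← hf] at this
        obtain ⟨y, -, hy⟩ := Finset.mem_map.mp this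
        exact ⟨y, hy⟩
      rw [map_mem_famMap]
      rintro rfl
      exact he.ne hf
    · rintro ⟨t, ht, rfl⟩
      rw [Set.mem_ofPred_eq, ← hf, Finset.ssubset_iff_subset_ne]
      exact ⟨Finset.map_subset_map.mpr (Finset.subset_univ t),
        fun h => ht (Finset.map_injective f h)⟩

theorem IsDownClosed.boundaryJoin {V : Type} {T : Set (Finset V)} (hT : IsDownClosed T)
    (A : Finset V) : IsDownClosed (boundaryJoin A T) := fun _ hs _ hts =>
  ⟨fun h => hs.1 (h.trans hts), hT _ hs.2 _ (Finset.sdiff_subset_sdiff hts le_rfl)⟩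

theorem empty_mem_boundaryJoin {V : Type} {T : Set (Finset V)} (h₀ : ∅ ∈ T) {A : Finset V}
    (hA : A.Nonempty) : ∅ ∈ boundaryJoin A T :=
  ⟨fun h => hA.ne_empty (Finset.subset_empty.mp h), by simpa using h₀⟩

theorem boundaryJoin_stellarAt {V : Type} {A σ : Finset V} {a : V} (T : Set (Finset V))
    (hσ : Disjoint σ A) (ha : a ∉ A) :
    boundaryJoin A (stellarAt T σ a) = stellarAt (boundaryJoin A T) σ a := by
  ext s
  have h₁ : A ⊆ s.erase a ↔ A ⊆ s :=
    ⟨fun h => h.trans (Finset.erase_subset _ _), fun h x hx =>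
      Finset.mem_erase.mpr ⟨fun hxa => ha (hxa ▸ hx), h hx⟩⟩
  have h₂ : s.erase a \ A = (s \ A).erase a := by
    ext x; simp only [Finset.mem_sdiff, Finset.mem_erase]; tauto
  have h₃ : σ ⊆ (s \ A).erase a ↔ σ ⊆ s.erase a := by
    rw [← h₂]
    exact ⟨fun h => h.trans Finset.sdiff_subset, fun h => Finset.subset_sdiff.mpr ⟨h, hσ⟩⟩
  have h₄ : A ⊆ σ ∪ s.erase a ↔ A ⊆ s.erase a :=
    ⟨fun h x hx => (Finset.mem_union.mp (h hx)).resolve_left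
      fun hxσ => Finset.disjoint_left.mp hσ hxσ hx, fun h => h.trans Finset.subset_union_right⟩
  have h₅ : (σ ∪ s.erase a) \ A = σ ∪ (s \ A).erase a := by
    rw [Finset.union_sdiff_distrib, Finset.sdiff_eq_self_of_disjoint hσ, h₂]
  have h₆ : a ∈ s \ A ↔ a ∈ s := by simp [ha]
  simp only [boundaryJoin, stellarAt, Set.mem_ofPred_eq, h₄, h₁, h₂, h₃, h₅, h₆]
  tauto

/-- The join `∂A * ∂B` is the boundary of the simplex `A ∪ (B \ b)` starred at its face `A`, with
`b` as the new vertex. The face is proper because `B` has a second vertex `c`. -/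
theorem isSphereFamily_boundaryJoin_ssubsets {V : Type} {A B : Finset V} (hA : A.Nonempty)
    (hB : 2 ≤ B.card) (h : Disjoint A B) : IsSphereFamily (boundaryJoin A {e | e ⊂ B}) := by
  obtain ⟨b, hb⟩ : B.Nonempty := Finset.card_pos.mp (by omega)
  obtain ⟨c, hc, hcb⟩ := Finset.exists_mem_ne (by omega : 1 < B.card) b
  have hbA : b ∉ A := Finset.disjoint_right.mp h hb
  have hcA : c ∉ A := Finset.disjoint_right.mp h hc
  have heq : boundaryJoin A {e | e ⊂ B} = stellarAt {e | e ⊂ A ∪ B.erase b} A b := by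
    ext s
    simp only [boundaryJoin, stellarAt, Set.mem_ofPred_eq]
    have h₁ : A ⊆ s.erase b ↔ A ⊆ s :=
      ⟨fun h => h.trans (Finset.erase_subset _ _), fun h x hx =>
        Finset.mem_erase.mpr ⟨fun hxb => hbA (hxb ▸ hx), h hx⟩⟩
    rw [h₁]
    constructor
    · rintro ⟨hAs, hs⟩
      have hsub : s.erase b ⊆ A ∪ B.erase b := fun x hx => by
        rw [Finset.mem_erase] at hx
        by_cases hxA : x ∈ A
        · exact Finset.mem_union_left _ hxA
        · exact Finset.mem_union_right _
            (Finset.mem_erase.mpr ⟨hx.1, hs.1 (Finset.mem_sdiff.mpr ⟨hx.2, hxA⟩)⟩)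
      refine ⟨⟨hsub, fun hc => hAs fun x hx => ?_⟩, hAs, fun hbs =>
        ⟨Finset.union_subset Finset.subset_union_left hsub, fun hsup => hs.2 fun x hx => ?_⟩⟩
      · exact Finset.mem_of_mem_erase (hc (Finset.mem_union_left _ hx))
      · have hxA : x ∉ A := Finset.disjoint_right.mp h hx
        refine Finset.mem_sdiff.mpr ⟨?_, hxA⟩
        by_cases hxb : x = b
        · exact hxb ▸ hbs
        · have := hsup (Finset.mem_union_right _ (Finset.mem_erase.mpr ⟨hxb, hx⟩))
          exact Finset.mem_of_mem_erase ((Finset.mem_union.mp this).resolve_left hxA)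
    · rintro ⟨hs, hAs, hbs⟩
      refine ⟨hAs, fun x hx => ?_, fun hsup => ?_⟩
      · rw [Finset.mem_sdiff] at hx
        by_cases hxb : x = b
        · exact hxb ▸ hb
        · have := hs.1 (Finset.mem_erase.mpr ⟨hxb, hx.1⟩)
          exact Finset.mem_of_mem_erase ((Finset.mem_union.mp this).resolve_left hx.2)
      · refine (hbs (Finset.mem_sdiff.mp (hsup hb)).1).2
          (Finset.union_subset_union_right fun x hx => ?_)
        rw [Finset.mem_erase] at hx
        exact Finset.mem_erase.mpr ⟨hx.1, (Finset.mem_sdiff.mp (hsup hx.2)).1⟩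
  rw [heq, isSphereFamily_stellarAt_iff _ _ hA]
  · exact isSphereFamily_ssubsets (hA.mono Finset.subset_union_left)
  · intro s hs hbs
    have := hs.1 hbs
    simp [hbA] at this
  · exact fun s hs t hts => lt_of_le_of_lt hts hs
  · refine ⟨Finset.subset_union_left, fun hsup => hcA (hsup ?_)⟩
    exact Finset.mem_union_right _ (Finset.mem_erase.mpr ⟨hcb, hc⟩)

/-- Joining with `∂A` commutes with starring away from `A`, so stellar moves on `L` become stellar
moves on the join. The ambient type is quantified inside the induction since moves change the vertex
set. -/
theorem IsPLSphere.isSphereFamily_boundaryJoin {W : Type} {L : AbstractSimplicialComplex W}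
    (hL : IsPLSphere L) : ∀ (V : Type) (f : W ↪ V) (A : Finset V), A.Nonempty →
      (∀ w, f w ∉ A) → IsSphereFamily (boundaryJoin A (famMap f (simplices L))) := by
  refine hL.family_induction (Q := fun {W} S => ∀ (V : Type) (f : W ↪ V) (A : Finset V),
    A.Nonempty → (∀ w, f w ∉ A) → IsSphereFamily (boundaryJoin A (famMap f S))) ?_ ?_ ?_
  · intro d V f A hA hf
    have h : famMap f {s | s ≠ Finset.univ} = {e | e ⊂ Finset.univ.map f} := by
      ext e
      constructor
      · rintro ⟨t, ht, rfl⟩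
        rw [Set.mem_ofPred_eq, Finset.ssubset_iff_subset_ne]
        exact ⟨Finset.map_subset_map.mpr (Finset.subset_univ t),
          fun h => ht (Finset.map_injective f h)⟩
      · intro he
        obtain ⟨t, rfl⟩ := exists_map_eq f e fun x hx => by
          obtain ⟨y, -, hy⟩ := Finset.mem_map.mp (he.1 hx)
          exact ⟨y, hy⟩
        rw [map_mem_famMap]
        rintro rfl
        exact (Finset.ssubset_def.mp he).2 le_rfl
    rw [h]
    refine isSphereFamily_boundaryJoin_ssubsets hA (by simp) ?_
    rw [Finset.disjoint_right]
    intro x hx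
    obtain ⟨y, -, rfl⟩ := Finset.mem_map.mp hx
    exact hf y
  · intro U W e S _ _ hQ V f A hA hf
    rw [famMap_famMap]
    exact hQ V _ A hA fun w => hf _
  · intro W S σ hS hσ hcard
    have hne : σ.Nonempty := Finset.card_pos.mp (by omega)
    have h₀ : ∅ ∈ S := hS _ hσ _ (by simp)
    have key : ∀ (V : Type) (f : Option W ↪ V) (A : Finset V), A.Nonempty → (∀ w, f w ∉ A) →
        (IsSphereFamily (boundaryJoin A (famMap f (stellarAt (famMap Function.Embedding.some S)
          (σ.map Function.Embedding.some) none))) ↔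
        IsSphereFamily (boundaryJoin A (famMap (Function.Embedding.some.trans f) S))) := by
      intro V f A hA hf
      have hdisj : ∀ t : Finset W, Disjoint ((t.map Function.Embedding.some).map f) A := by
        intro t
        rw [Finset.disjoint_left]
        intro x hx
        obtain ⟨y, -, rfl⟩ := Finset.mem_map.mp hx
        exact hf y
      rw [← famMap_stellarAt, boundaryJoin_stellarAt _ (hdisj σ) (hf none), famMap_famMap]
      refine isSphereFamily_stellarAt_iff ((hS.famMap _).boundaryJoin A) ?_ ?_ ?_
      · refine ⟨fun h => ?_, ?_⟩
        · obtain ⟨x, hx⟩ := hA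
          exact Finset.disjoint_left.mp (hdisj σ) (h hx) hx
        · rw [Finset.sdiff_eq_self_of_disjoint (hdisj σ), Finset.map_map, map_mem_famMap]
          exact hσ
      · simpa using hne
      · intro s hs hn
        obtain ⟨y, hy⟩ := exists_of_mem_of_mem_famMap hs.2
          (Finset.mem_sdiff.mpr ⟨hn, hf none⟩)
        exact absurd (f.injective hy) (by simp)
    constructor
    -- Undoing a subdivision needs a spare vertex for the starring point, and `V` may have none
    -- outside `A` and the image of `f`; the ground set is enlarged to `Option V` and the result
    -- pulled back.
    · intro hQ V f A hA hf
      let g : Option W ↪ Option V := f.optionMap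
      have hg : ∀ w, g w ∉ A.map Function.Embedding.some := by
        rintro (_ | w)
        · simp [g]
        · simpa [g] using hf w
      have := (key _ g _ (by simpa using hA) hg).mp (hQ _ g _ (by simpa using hA) hg)
      have hcomp : Function.Embedding.some.trans g = f.trans Function.Embedding.some := by
        ext w; simp [g]
      rwa [hcomp, ← famMap_famMap, famMap_boundaryJoin, isSphereFamily_famMap_iff] at this
      · exact (hS.famMap f).boundaryJoin A
      · exact empty_mem_boundaryJoin (show ∅ ∈ famMap f S from ⟨∅, h₀, by simp⟩) hA
    · intro hQ V f A hA hf
      exact (key V f A hA hf).mpr (hQ V _ A hA fun w => hf _)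

theorem IsSphereFamily.boundaryJoin {V : Type} {T : Set (Finset V)} (hT : IsSphereFamily T)
    {A : Finset V} (hA : A.Nonempty) (hdisj : ∀ t ∈ T, Disjoint t A) :
    IsSphereFamily (boundaryJoin A T) := by
  rcases hT with rfl | ⟨W, L, f, hL, rfl⟩
  · have h : ToricWedge.boundaryJoin A {∅} = {e | e ⊂ A} := by
      ext e
      simp only [ToricWedge.boundaryJoin, Set.mem_ofPred_eq, Set.mem_singleton_iff,
        Finset.sdiff_eq_empty_iff_subset]
      exact ⟨fun h => ⟨h.2, h.1⟩, fun h => ⟨h.2, h.1⟩⟩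
    rw [h]
    exact isSphereFamily_ssubsets hA
  · refine hL.isSphereFamily_boundaryJoin V f A hA fun w => ?_
    have := hdisj _ ⟨{w}, isSimplex_singleton L w, rfl⟩
    simpa using this

/-! ### Links and purity -/

/-- The links of all nonempty members of the family are spheres. -/
def HasSphericalLinks {V : Type} (S : Set (Finset V)) : Prop :=
  ∀ τ ∈ S, τ.Nonempty → IsSphereFamily (famLink S τ)

theorem famLink_stellarAt_of_union_notMem {V : Type} {S : Set (Finset V)} (hS : IsDownClosed S)
    {σ τ : Finset V} {a : V} (ha : ∀ s ∈ S, a ∉ s) (haτ : a ∉ τ) (h : σ ∪ τ ∉ S) :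
    famLink (stellarAt S σ a) τ = famLink S τ := by
  have hsub : ∀ ρ : Finset V, τ ⊆ (τ ∪ ρ).erase a := fun ρ x hx =>
    Finset.mem_erase.mpr ⟨fun hxa => haτ (hxa ▸ hx), Finset.mem_union_left _ hx⟩
  ext ρ
  refine and_congr_left fun _ => ⟨fun hρ => ?_, fun hρ => ?_⟩
  · have han : a ∉ τ ∪ ρ := fun hn =>
      h (hS _ (hρ.2.2 hn) _ (Finset.union_subset_union_right (hsub ρ)))
    have := hρ.1
    rwa [Finset.erase_eq_of_notMem han] at this
  · have han := ha _ hρ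
    refine ⟨by rwa [Finset.erase_eq_of_notMem han], fun hc => h (hS _ hρ _ ?_),
      fun hn => absurd hn han⟩
    rw [Finset.erase_eq_of_notMem han] at hc
    exact Finset.union_subset hc Finset.subset_union_left

theorem famLink_stellarAt_of_notMem {V : Type} (S : Set (Finset V))
    {σ τ : Finset V} {a : V} (haτ : a ∉ τ) :
    famLink (stellarAt S σ a) τ =
      {ρ | (τ ∪ ρ.erase a ∈ S ∧ ¬ σ \ τ ⊆ ρ.erase a ∧ (a ∈ ρ → τ ∪ (σ \ τ ∪ ρ.erase a) ∈ S)) ∧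
        Disjoint τ ρ} := by
  ext ρ
  have h₁ : (τ ∪ ρ).erase a = τ ∪ ρ.erase a := by
    rw [Finset.erase_union_distrib, Finset.erase_eq_of_notMem haτ]
  have h₂ : τ ∪ (σ \ τ ∪ ρ.erase a) = σ ∪ (τ ∪ ρ.erase a) := by
    ext x; simp only [Finset.mem_union, Finset.mem_sdiff]; tauto
  have h₃ : σ \ τ ⊆ ρ.erase a ↔ σ ⊆ τ ∪ ρ.erase a := by
    rw [sdiff_le_iff (a := σ) (b := τ) (c := ρ.erase a)]
    rfl
  have h₄ : a ∈ τ ∪ ρ ↔ a ∈ ρ := by simp [haτ]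
  simp only [famLink, stellarAt, Set.mem_ofPred_eq, h₁, h₂, h₃, h₄]

/-- Away from the new vertex, taking links commutes with starring. This is a genuine stellar move on
the link only when `σ ∪ τ` is a simplex; otherwise `famLink_stellarAt_of_union_notMem` applies. -/
theorem famLink_stellarAt_eq {V : Type} {S : Set (Finset V)}
    {σ τ : Finset V} {a : V} (haτ : a ∉ τ) :
    famLink (stellarAt S σ a) τ = stellarAt (famLink S τ) (σ \ τ) a := by
  rw [famLink_stellarAt_of_notMem S haτ]
  ext ρ
  have h₁ : Disjoint τ (ρ.erase a) ↔ Disjoint τ ρ := by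
    simp only [Finset.disjoint_left, Finset.mem_erase, not_and]
    exact ⟨fun h x hx => h hx fun hxa => haτ (hxa ▸ hx), fun h x hx _ => h hx⟩
  have h₂ : Disjoint τ (σ \ τ ∪ ρ.erase a) ↔ Disjoint τ ρ := by
    rw [Finset.disjoint_union_right, h₁]
    exact ⟨fun h => h.2, fun h => ⟨Finset.disjoint_sdiff, h⟩⟩
  simp only [famLink, stellarAt, Set.mem_ofPred_eq, h₁, h₂]
  tauto

/-- The star of the new vertex is `a * ∂σ * lk σ`; removing `ρ` from it leaves `∂(σ \ ρ)` joined
with the link of `σ ∪ ρ`. This is where spheres of the form `∂A * T` enter. -/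
theorem famLink_stellarAt_insert {V : Type} {S : Set (Finset V)} (hS : IsDownClosed S)
    {σ ρ : Finset V} {a : V} (ha : ∀ s ∈ S, a ∉ s) (haρ : a ∉ ρ) (haσ : a ∉ σ) :
    famLink (stellarAt S σ a) (insert a ρ) = boundaryJoin (σ \ ρ) (famLink S (σ ∪ ρ)) := by
  ext s
  constructor
  · rintro ⟨⟨-, h₂, h₃⟩, hd⟩
    rw [Finset.disjoint_insert_left] at hd
    have he : (insert a ρ ∪ s).erase a = ρ ∪ s := by
      rw [Finset.insert_union, Finset.erase_insert]
      simp [haρ, hd.1]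
    rw [he] at h₂ h₃
    refine ⟨fun h => h₂ fun x hx => ?_, ?_, ?_⟩
    · by_cases hxρ : x ∈ ρ
      · exact Finset.mem_union_left _ hxρ
      · exact Finset.mem_union_right _ (h (Finset.mem_sdiff.mpr ⟨hx, hxρ⟩))
    · refine hS _ (h₃ (by simp)) _ fun x hx => ?_
      simp only [Finset.mem_union, Finset.mem_sdiff] at hx ⊢
      tauto
    · rw [Finset.disjoint_left]
      intro x hx hxs
      have := fun h : x ∈ ρ => Finset.disjoint_left.mp hd.2 h
      simp only [Finset.mem_union, Finset.mem_sdiff] at hx hxs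
      tauto
  · rintro ⟨h₁, h₂, h₃⟩
    have has : a ∉ s := fun h =>
      ha _ h₂ (Finset.mem_union_right _ (Finset.mem_sdiff.mpr ⟨h, by simp [haσ]⟩))
    have hdisj : Disjoint ρ s := by
      rw [Finset.disjoint_left]
      intro x hx hxs
      refine Finset.disjoint_left.mp h₃ (Finset.mem_union_right _ hx)
        (Finset.mem_sdiff.mpr ⟨hxs, by simp [hx]⟩)
    have he : (insert a ρ ∪ s).erase a = ρ ∪ s := by
      rw [Finset.insert_union, Finset.erase_insert]
      simp [haρ, has]
    have hmem : σ ∪ (ρ ∪ s) ∈ S := by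
      refine hS _ h₂ _ fun x hx => ?_
      simp only [Finset.mem_union, Finset.mem_sdiff] at hx ⊢
      tauto
    refine ⟨?_, Finset.disjoint_insert_left.mpr ⟨has, hdisj⟩⟩
    simp only [stellarAt, Set.mem_ofPred_eq, he]
    refine ⟨hS _ hmem _ Finset.subset_union_right, fun h => h₁ fun x hx => ?_, fun _ => hmem⟩
    rw [Finset.mem_sdiff] at hx
    exact (Finset.mem_union.mp (h hx.1)).resolve_left hx.2

theorem hasSphericalLinks_stellarAt_iff {V : Type} {S : Set (Finset V)} (hS : IsDownClosed S)
    {σ : Finset V} (hσ : σ ∈ S) (hne : σ.Nonempty) {a : V} (ha : ∀ s ∈ S, a ∉ s) :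
    HasSphericalLinks (stellarAt S σ a) ↔ HasSphericalLinks S := by
  have haσ : a ∉ σ := ha _ hσ
  have key : ∀ τ ∈ S, ¬ σ ⊆ τ →
      (IsSphereFamily (famLink (stellarAt S σ a) τ) ↔ IsSphereFamily (famLink S τ)) := by
    intro τ hτ hστ
    by_cases h : σ ∪ τ ∈ S
    · rw [famLink_stellarAt_eq (ha _ hτ)]
      refine isSphereFamily_stellarAt_iff (hS.famLink τ) ⟨?_, Finset.disjoint_sdiff⟩
        (Finset.sdiff_nonempty.mpr hστ) fun s hs has => ha _ hs.1 (Finset.mem_union_right _ has)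
      rwa [Finset.union_sdiff_self_eq_union, Finset.union_comm]
    · rw [famLink_stellarAt_of_union_notMem hS ha (ha _ hτ) h]
  constructor
  · intro H τ hτ hτne
    by_cases hστ : σ ⊆ τ
    -- The simplex `τ` is destroyed by the subdivision. Replacing one vertex `x ∈ σ` of it by `a`
    -- gives a surviving simplex with the same link, since `σ \ (τ \ x) = {x}` and `∂{x}`
    -- contributes only the empty face.
    · obtain ⟨x, hx⟩ := hne
      have haτ : a ∉ τ.erase x := fun h => ha _ hτ (Finset.mem_of_mem_erase h)
      have hσx : σ \ τ.erase x = {x} := by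
        ext y
        simp only [Finset.mem_sdiff, Finset.mem_erase, Finset.mem_singleton]
        constructor
        · rintro ⟨h₁, h₂⟩
          by_contra hyx
          exact h₂ ⟨hyx, hστ h₁⟩
        · rintro rfl
          exact ⟨hx, by simp⟩
      have hστx : σ ∪ τ.erase x = τ := by
        ext y
        simp only [Finset.mem_union, Finset.mem_erase]
        constructor
        · rintro (h | h)
          · exact hστ h
          · exact h.2
        · intro h
          by_cases hyx : y = x
          · exact Or.inl (hyx ▸ hx)
          · exact Or.inr ⟨hyx, h⟩
      have hmem : insert a (τ.erase x) ∈ stellarAt S σ a := by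
        simp only [stellarAt, Set.mem_ofPred_eq, Finset.erase_insert haτ, hστx]
        exact ⟨hS _ hτ _ (Finset.erase_subset _ _), fun h => by simpa using h hx, fun _ => hτ⟩
      have := H _ hmem (Finset.insert_nonempty _ _)
      rw [famLink_stellarAt_insert hS ha haτ haσ, hσx, hστx] at this
      convert this using 1
      ext s
      have hx' : ∀ s ∈ famLink S τ, x ∉ s := fun s hs hxs =>
        Finset.disjoint_left.mp hs.2 (hστ hx) hxs
      constructor
      · intro hs
        refine ⟨by simpa using hx' s hs, ?_⟩
        rwa [Finset.sdiff_singleton_eq_erase, Finset.erase_eq_of_notMem (hx' s hs)]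
      · rintro ⟨h₁, h₂⟩
        rw [Finset.singleton_subset_iff] at h₁
        rwa [Finset.sdiff_singleton_eq_erase, Finset.erase_eq_of_notMem h₁] at h₂
    · refine (key τ hτ hστ).mp (H τ ?_ hτne)
      have := ha _ hτ
      simp only [stellarAt, Set.mem_ofPred_eq, Finset.erase_eq_of_notMem this]
      exact ⟨hτ, hστ, fun h => absurd h this⟩
  · intro H τ hτ hτne
    by_cases haτ : a ∈ τ
    · have hmem := hτ.2.2 haτ
      have hne' : (σ \ τ.erase a).Nonempty := Finset.sdiff_nonempty.mpr hτ.2.1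
      rw [← Finset.insert_erase haτ, famLink_stellarAt_insert hS ha (by simp) haσ]
      refine (H _ hmem (hne.mono Finset.subset_union_left)).boundaryJoin hne' fun t ht => ?_
      exact (ht.2.mono_left (Finset.sdiff_subset.trans Finset.subset_union_left)).symm
    · obtain ⟨h₁, h₂, -⟩ := hτ
      rw [Finset.erase_eq_of_notMem haτ] at h₁ h₂
      exact (key τ h₁ h₂).mpr (H τ h₁ hτne)

theorem hasSphericalLinks_famMap_iff {V W : Type} (f : V ↪ W) {S : Set (Finset V)}
    (hS : IsDownClosed S) : HasSphericalLinks (famMap f S) ↔ HasSphericalLinks S := by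
  have key : ∀ τ ∈ S, (IsSphereFamily (famLink (famMap f S) (τ.map f)) ↔
      IsSphereFamily (famLink S τ)) := fun τ hτ => by
    rw [famMap_famLink]
    exact isSphereFamily_famMap_iff f (hS.famLink τ) ⟨by simpa using hτ, by simp⟩
  constructor
  · exact fun H τ hτ hne => (key τ hτ).mp (H _ ⟨τ, hτ, rfl⟩ (by simpa using hne))
  · rintro H _ ⟨τ, hτ, rfl⟩ hne
    exact (key τ hτ).mpr (H τ hτ (by simpa using hne))

theorem IsPLSphere.hasSphericalLinks {V : Type} {K : AbstractSimplicialComplex V}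
    (hK : IsPLSphere K) : HasSphericalLinks (simplices K) := by
  refine hK.family_induction (Q := fun S => HasSphericalLinks S) ?_ ?_ ?_
  · intro d τ hτ hne
    have h : famLink {s : Finset (Fin (d + 2)) | s ≠ Finset.univ} τ = {e | e ⊂ τᶜ} := by
      ext e
      have h₁ : Disjoint τ e ↔ e ⊆ τᶜ := by
        rw [Finset.subset_compl_iff_disjoint_left]
      simp only [famLink, Set.mem_ofPred_eq, ne_eq, h₁, Finset.ssubset_def]
      rw [and_comm]
      refine and_congr_right fun _ => not_congr ?_
      simp only [Finset.eq_univ_iff_forall, Finset.mem_union, Finset.subset_iff,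
        Finset.mem_compl]
      exact forall_congr' fun x => or_iff_not_imp_left
    rw [h]
    refine isSphereFamily_ssubsets ?_
    rw [Finset.nonempty_iff_ne_empty, ne_eq, Finset.compl_eq_empty_iff]
    exact hτ
  · exact fun e S hS _ => (hasSphericalLinks_famMap_iff _ hS).mpr
  · intro V S σ hS hσ hcard
    have hne : σ.Nonempty := Finset.card_pos.mp (by omega)
    rw [hasSphericalLinks_stellarAt_iff (hS.famMap _) ((map_mem_famMap _ _ _).mpr hσ)
      (by simpa using hne), hasSphericalLinks_famMap_iff _ hS]
    rintro _ ⟨t, -, rfl⟩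
    simp

/-- Every member of the family lies in a member with `n` elements, the largest possible number. -/
def IsPure {V : Type} (S : Set (Finset V)) (n : ℕ) : Prop :=
  ∀ s ∈ S, s.card ≤ n ∧ ∃ t ∈ S, s ⊆ t ∧ t.card = n

theorem isPure_famMap_iff {V W : Type} (f : V ↪ W) (S : Set (Finset V)) (n : ℕ) :
    IsPure (famMap f S) n ↔ IsPure S n := by
  simp [IsPure, famMap]

/-- Subdivision replaces each facet containing `σ` by facets in which one vertex of `σ` is traded
for `a`, which preserves cardinality. -/
theorem isPure_stellarAt_iff {V : Type} {S : Set (Finset V)} (hS : IsDownClosed S)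
    {σ : Finset V} (hne : σ.Nonempty) {a : V} (ha : ∀ s ∈ S, a ∉ s) (n : ℕ) :
    IsPure (stellarAt S σ a) n ↔ IsPure S n := by
  have hold : ∀ s ∈ S, ¬ σ ⊆ s → s ∈ stellarAt S σ a := fun s hs hσs => by
    have := ha _ hs
    simp only [stellarAt, Set.mem_ofPred_eq, Finset.erase_eq_of_notMem this]
    exact ⟨hs, hσs, fun h => absurd h this⟩
  have hnew : ∀ s ∈ S, ∀ x ∈ σ, σ ⊆ s → insert a (s.erase x) ∈ stellarAt S σ a := by
    intro s hs x hx hσs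
    have : a ∉ s.erase x := fun h => ha _ hs (Finset.mem_of_mem_erase h)
    simp only [stellarAt, Set.mem_ofPred_eq, Finset.erase_insert this]
    refine ⟨hS _ hs _ (Finset.erase_subset _ _), fun h => by simpa using h hx, fun _ => ?_⟩
    exact hS _ hs _ (Finset.union_subset hσs (Finset.erase_subset _ _))
  have hcard : ∀ s ∈ S, ∀ x ∈ s, (insert a (s.erase x)).card = s.card := by
    intro s hs x hx
    rw [Finset.card_insert_of_notMem fun h => ha _ hs (Finset.mem_of_mem_erase h),
      Finset.card_erase_add_one hx]
  have hlt : ∀ s : Finset V, ¬ σ ⊆ s → s.card < (σ ∪ s).card := fun s hs =>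
    Finset.card_lt_card ⟨Finset.subset_union_right, fun h =>
      hs (Finset.subset_union_left.trans h)⟩
  constructor
  · intro H
    have hle : ∀ s ∈ S, s.card ≤ n := by
      intro s hs
      by_cases hσs : σ ⊆ s
      · obtain ⟨x, hx⟩ := hne
        rw [← hcard s hs x (hσs hx)]
        exact (H _ (hnew s hs x hx hσs)).1
      · exact (H s (hold s hs hσs)).1
    have hext : ∀ t ∈ stellarAt S σ a, a ∈ t → t.card = n → (σ ∪ t.erase a).card = n := by
      intro t ht hat htn
      have h₁ := hle _ (ht.2.2 hat)
      have h₂ := hlt _ ht.2.1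
      have h₃ := Finset.card_erase_add_one hat
      omega
    intro s hs
    refine ⟨hle s hs, ?_⟩
    by_cases hσs : σ ⊆ s
    · obtain ⟨x, hx⟩ := hne
      obtain ⟨-, t, ht, hst, htn⟩ := H _ (hnew s hs x hx hσs)
      have hat : a ∈ t := hst (by simp)
      refine ⟨_, ht.2.2 hat, fun y hy => ?_, hext t ht hat htn⟩
      by_cases hyx : y = x
      · exact Finset.mem_union_left _ (hyx ▸ hx)
      · refine Finset.mem_union_right _ (Finset.mem_erase.mpr ⟨fun h => ha _ hs (h ▸ hy), hst ?_⟩)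
        exact Finset.mem_insert_of_mem (Finset.mem_erase.mpr ⟨hyx, hy⟩)
    · obtain ⟨-, t, ht, hst, htn⟩ := H s (hold s hs hσs)
      by_cases hat : a ∈ t
      · refine ⟨_, ht.2.2 hat, fun y hy => ?_, hext t ht hat htn⟩
        exact Finset.mem_union_right _ (Finset.mem_erase.mpr ⟨fun h => ha _ hs (h ▸ hy), hst hy⟩)
      · refine ⟨t, ?_, hst, htn⟩
        have := ht.1
        rwa [Finset.erase_eq_of_notMem hat] at this
  · intro H s hs
    have hunion : σ ∪ s.erase a ∈ S → ∃ t ∈ stellarAt S σ a, s ⊆ t ∧ t.card = n := by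
      intro h
      obtain ⟨-, t, ht, hst, htn⟩ := H _ h
      obtain ⟨x, hx, hxs⟩ := Finset.not_subset.mp hs.2.1
      have hσt : σ ⊆ t := Finset.subset_union_left.trans hst
      refine ⟨_, hnew t ht x hx hσt, fun y hy => ?_, (hcard t ht x (hσt hx)).trans htn⟩
      by_cases hya : y = a
      · simp [hya]
      · have hys : y ∈ s.erase a := Finset.mem_erase.mpr ⟨hya, hy⟩
        exact Finset.mem_insert_of_mem (Finset.mem_erase.mpr
          ⟨fun h => hxs (h ▸ hys), hst (Finset.mem_union_right _ hys)⟩)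
    by_cases has : a ∈ s
    · have h := hs.2.2 has
      refine ⟨?_, hunion h⟩
      have h₁ := (H _ h).1
      have h₂ := hlt _ hs.2.1
      have h₃ := Finset.card_erase_add_one has
      omega
    · have hs' := hs.1
      have hσs := hs.2.1
      rw [Finset.erase_eq_of_notMem has] at hs' hσs
      refine ⟨(H s hs').1, ?_⟩
      by_cases h : σ ∪ s.erase a ∈ S
      · exact hunion h
      · rw [Finset.erase_eq_of_notMem has] at h
        obtain ⟨-, t, ht, hst, htn⟩ := H s hs'
        exact ⟨t, hold t ht fun hσt => h (hS _ ht _ (Finset.union_subset hσt hst)), hst, htn⟩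

theorem IsPLSphere.exists_isPure {V : Type} {K : AbstractSimplicialComplex V}
    (hK : IsPLSphere K) : ∃ n, IsPure (simplices K) n := by
  refine hK.family_induction (Q := fun S => ∃ n, IsPure S n) ?_ ?_ ?_
  · refine fun d => ⟨d + 1, fun s hs => ?_⟩
    obtain ⟨x, hx⟩ : ∃ x, x ∉ s := by
      by_contra! h
      exact hs (Finset.eq_univ_iff_forall.mpr h)
    have hsub : s ⊆ Finset.univ.erase x := fun y hy =>
      Finset.mem_erase.mpr ⟨fun h => hx (h ▸ hy), Finset.mem_univ y⟩
    have hcard : (Finset.univ.erase x).card = d + 1 := by simp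
    refine ⟨hcard ▸ Finset.card_le_card hsub, Finset.univ.erase x, fun h => ?_, hsub, hcard⟩
    have := Finset.mem_univ x
    rw [← h] at this
    simp at this
  · exact fun e S _ _ ⟨n, hn⟩ => ⟨n, (isPure_famMap_iff _ S n).mpr hn⟩
  · intro V S σ hS hσ hcard
    have hne : σ.Nonempty := Finset.card_pos.mp (by omega)
    refine exists_congr fun n => ?_
    rw [isPure_stellarAt_iff (hS.famMap _) (by simpa using hne), isPure_famMap_iff]
    rintro _ ⟨t, -, rfl⟩
    simp

theorem IsPLSphere.exists_ne {V : Type} {K : AbstractSimplicialComplex V}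
    (hK : IsPLSphere K) (x : V) : ∃ y, y ≠ x := by
  obtain ⟨u, v, huv⟩ : ∃ u v : V, u ≠ v := by
    refine hK.family_induction (Q := fun {V} _ => ∃ u v : V, u ≠ v) ?_ ?_ ?_
    · exact fun d => ⟨0, 1, by simp⟩
    · exact fun e S _ _ ⟨u, v, huv⟩ => ⟨e u, e v, e.injective.ne huv⟩
    · intro V S σ _ _ hcard
      obtain ⟨u, -, v, -, huv⟩ := Finset.one_lt_card.mp hcard
      exact iff_of_true ⟨some u, some v, by simpa using huv⟩ ⟨u, v, huv⟩
  by_cases h : u = x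
  · exact ⟨v, fun hv => huv (h.trans hv.symm)⟩
  · exact ⟨u, h⟩

/-! ### Wedges and suspensions -/

theorem IsSphereFamily.exists_singleton_ne {V : Type} {S : Set (Finset V)} (hS : IsSphereFamily S)
    {x : V} (hx : {x} ∈ S) : ∃ y, y ≠ x ∧ {y} ∈ S := by
  rcases hS with rfl | ⟨W, L, f, hL, rfl⟩
  · simp at hx
  · obtain ⟨w, rfl⟩ := exists_of_mem_of_mem_famMap hx (Finset.mem_singleton_self x)
    obtain ⟨y, hy⟩ := hL.exists_ne w
    exact ⟨f y, f.injective.ne hy, {y}, isSimplex_singleton L y, by simp⟩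

theorem IsPLSphere.isSphereFamily_famLink {V : Type} {K : AbstractSimplicialComplex V}
    (hK : IsPLSphere K) {τ : Finset V} (hτ : IsSimplex K τ) :
    IsSphereFamily (famLink (simplices K) τ) := by
  rcases τ.eq_empty_or_nonempty with rfl | hne
  · have : famLink (simplices K) ∅ = famMap (Function.Embedding.refl V) (simplices K) := by
      simp [famLink, famMap]
    exact Or.inr ⟨V, K, _, hK, this⟩
  · exact hK.hasSphericalLinks τ hτ hne

/-- If every simplex of a PL sphere extends to one containing `i` or `j`, then every simplex
avoiding both spans a simplex with `j` as soon as it spans one with `i`. -/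
theorem IsPLSphere.exchange {V : Type} {K : AbstractSimplicialComplex V} (hK : IsPLSphere K)
    {i j : V} (hext : ∀ s, IsSimplex K s → ∃ t, IsSimplex K t ∧ s ⊆ t ∧ (i ∈ t ∨ j ∈ t))
    {τ : Finset V} (hi : i ∉ τ) (hτ : IsSimplex K (insert i τ)) : IsSimplex K (insert j τ) := by
  obtain ⟨n, hn⟩ := hK.exists_isPure
  obtain ⟨-, F, hF, hτF, hFn⟩ := hn _ hτ
  by_cases hjF : j ∈ F
  · exact isSimplex_mono hF (Finset.insert_subset hjF ((Finset.subset_insert i τ).trans hτF))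
  have hiF : i ∈ F := hτF (Finset.mem_insert_self i τ)
  -- The link of the ridge `F \ i` is a sphere having `i` as a vertex, hence it has another vertex
  -- `x`. A simplex extending `(F \ i) ∪ {x}` cannot contain `i` for reasons of size, so it can be
  -- chosen to contain `j`.
  have hlink : {i} ∈ famLink (simplices K) (F.erase i) := by
    refine ⟨?_, by simp⟩
    rwa [Finset.union_comm, ← Finset.insert_eq, Finset.insert_erase hiF]
  obtain ⟨x, hxi, hx, hdisj⟩ := (hK.isSphereFamily_famLink
    (isSimplex_mono hF (Finset.erase_subset i F))).exists_singleton_ne hlink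
  rw [Finset.disjoint_singleton_right, Finset.mem_erase] at hdisj
  have hxF : x ∉ F := fun h => hdisj ⟨hxi, h⟩
  obtain ⟨G, hG, hsub, h⟩ := hext _ hx
  have hFG : F.erase i ⊆ G := Finset.subset_union_left.trans hsub
  have hxG : x ∈ G := hsub (by simp)
  have hiG : i ∉ G := fun hiG => by
    have h₁ : insert x F ⊆ G := Finset.insert_subset hxG fun y hy => by
      by_cases hyi : y = i
      · exact hyi ▸ hiG
      · exact hFG (Finset.mem_erase.mpr ⟨hyi, hy⟩)
    have h₂ := Finset.card_le_card h₁
    rw [Finset.card_insert_of_notMem hxF, hFn] at h₂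
    have h₃ := (hn G hG).1
    omega
  have hjG := h.resolve_left hiG
  refine isSimplex_mono hG (Finset.insert_subset hjG fun y hy => hFG ?_)
  exact Finset.mem_erase.mpr ⟨fun h => hi (h ▸ hy), hτF (Finset.mem_insert_of_mem hy)⟩

theorem IsPLSphere.insert_mem {V : Type} {K : AbstractSimplicialComplex V} (hK : IsPLSphere K)
    {i j : V} (hext : ∀ s, IsSimplex K s → ∃ t, IsSimplex K t ∧ s ⊆ t ∧ (i ∈ t ∨ j ∈ t))
    {τ : Finset V} (hj : j ∉ τ) (hτ : IsSimplex K τ) : IsSimplex K (insert i τ) := by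
  obtain ⟨t, ht, hτt, hit | hjt⟩ := hext τ hτ
  · exact isSimplex_mono ht (Finset.insert_subset hit hτt)
  · refine hK.exchange (i := j) (j := i) (fun s hs => ?_) hj
      (isSimplex_mono ht (Finset.insert_subset hjt hτt))
    obtain ⟨t, ht, hst, h⟩ := hext s hs
    exact ⟨t, ht, hst, h.symm⟩

/-- A PL sphere all of whose simplices extend to ones containing `i` or `j` looks like the wedge
of the link of `i` at `j`. -/
theorem IsPLSphere.isSimplex_iff_of_extends {V : Type} {K : AbstractSimplicialComplex V}
    (hK : IsPLSphere K) {i j : V}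
    (hext : ∀ s, IsSimplex K s → ∃ t, IsSimplex K t ∧ s ⊆ t ∧ (i ∈ t ∨ j ∈ t)) (s : Finset V) :
    IsSimplex K s ↔ IsSimplex K (insert i (insert j ((s.erase i).erase j))) ∨
      (IsSimplex K (insert i ((s.erase i).erase j)) ∧ ¬ (j ∈ s ∧ i ∈ s)) := by
  have hi : i ∉ (s.erase i).erase j := by simp
  have hj : j ∉ (s.erase i).erase j := by simp
  constructor
  · intro hs
    by_cases hb : j ∈ s ∧ i ∈ s
    · left
      refine isSimplex_mono hs (Finset.insert_subset hb.2 (Finset.insert_subset hb.1 ?_))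
      exact (Finset.erase_subset _ _).trans (Finset.erase_subset _ _)
    · exact Or.inr ⟨hK.insert_mem hext hj (isSimplex_mono hs
        ((Finset.erase_subset _ _).trans (Finset.erase_subset _ _))), hb⟩
  · rintro (h | ⟨h, hb⟩)
    · refine isSimplex_mono h fun x hx => ?_
      simp only [Finset.mem_insert, Finset.mem_erase]
      tauto
    · by_cases hjs : j ∈ s
      · refine isSimplex_mono (hK.exchange hext hi h) fun x hx => ?_
        have : x ≠ i := fun h => hb ⟨hjs, h ▸ hx⟩
        simp only [Finset.mem_insert, Finset.mem_erase]
        tauto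
      · refine isSimplex_mono h fun x hx => ?_
        have : x ≠ j := fun h => hjs (h ▸ hx)
        simp only [Finset.mem_insert, Finset.mem_erase]
        tauto

theorem isSimplex_wedge {V : Type} (K : AbstractSimplicialComplex V) (v : V)
    (s : Finset (Option V)) :
    IsSimplex (wedge K v) s ↔ IsSimplex K (insert v ((Finset.eraseNone s).erase v)) ∨
      (IsSimplex K ((Finset.eraseNone s).erase v) ∧ ¬ (some v ∈ s ∧ none ∈ s)) := by
  refine (isSimplex_ofFamily ?_ s).trans ?_
  · refine Or.inl ⟨isSimplex_mono (isSimplex_singleton K v) fun x hx => ?_, by simp⟩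
    simpa using hx
  · have hd : Disjoint {v} ((Finset.eraseNone s).erase v) := by simp
    have hn : ¬ {v} ⊆ (Finset.eraseNone s).erase v := by simp
    simp only [Set.mem_ofPred_eq, link, deletion, hd, hn, and_true, not_false_eq_true,
      ← Finset.insert_eq]

/-- The condition `hL` makes `L` the link of `e none`, and `hK` is the wedge formula written inside
`K`. The criterion serves both for the sphere `K` and for its inflations. -/
theorem isIso_wedge {V W : Type} {K : AbstractSimplicialComplex V}
    {L : AbstractSimplicialComplex W} (e : Option W ≃ V) (v : W)
    (hL : ∀ t : Finset W, IsSimplex L t ↔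
      IsSimplex K (insert (e none) (t.map (Function.Embedding.some.trans e.toEmbedding))))
    (hK : ∀ s, IsSimplex K s ↔
      IsSimplex K (insert (e none) (insert (e (some v)) ((s.erase (e none)).erase (e (some v))))) ∨
      (IsSimplex K (insert (e none) ((s.erase (e none)).erase (e (some v)))) ∧
        ¬ (e (some v) ∈ s ∧ e none ∈ s))) :
    IsIso (wedge L v) K e := fun s => by
  have ht : ((Finset.eraseNone s).erase v).map (Function.Embedding.some.trans e.toEmbedding) =
      ((s.map e.toEmbedding).erase (e none)).erase (e (some v)) := by
    ext x
    obtain ⟨_ | x, rfl⟩ := e.surjective x <;> simp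
  have hv : e (some v) ∈ s.map e.toEmbedding ↔ some v ∈ s :=
    Finset.mem_map' e.toEmbedding (a := some v)
  have hi : e none ∈ s.map e.toEmbedding ↔ none ∈ s := Finset.mem_map' e.toEmbedding (a := none)
  rw [isSimplex_wedge, hK (s.map e.toEmbedding), hL, hL, Finset.map_insert, ht, hv, hi]
  rfl

/-- A PL sphere all of whose simplices extend to ones containing `i` or `j` is a wedge of a PL
sphere, if `i` and `j` are adjacent. -/
theorem IsPLSphere.exists_isIso_wedge {V : Type} {K : AbstractSimplicialComplex V}
    (hK : IsPLSphere K) {i j : V} (hij : i ≠ j)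
    (hext : ∀ s, IsSimplex K s → ∃ t, IsSimplex K t ∧ s ⊆ t ∧ (i ∈ t ∨ j ∈ t))
    (hedge : IsSimplex K {i, j}) :
    ∃ (W : Type) (L : AbstractSimplicialComplex W) (v : W) (e : Option W ≃ V),
      IsPLSphere L ∧ IsIso (wedge L v) K e := by
  have hj : {j} ∈ famLink (simplices K) {i} := ⟨hedge, by simpa using hij⟩
  rcases hK.isSphereFamily_famLink (isSimplex_singleton K i) with h | ⟨W, L, f, hL, h⟩
  · rw [h] at hj
    simp at hj
  have hfi : ∀ w, f w ≠ i := fun w hw => by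
    have : ({w} : Finset W).map f ∈ famLink (simplices K) {i} := by
      rw [h, map_mem_famMap]
      exact isSimplex_singleton L w
    simpa [hw] using this.2
  -- The base of the wedge is the link of `i`, so every other vertex must be adjacent to `i`: for
  -- `j` this is `hedge`, for the rest it follows from `insert_mem`.
  have hsurj : ∀ u, u ≠ i → ∃ w, f w = u := fun u hu => by
    refine exists_of_mem_of_mem_famMap (s := {u}) (S := simplices L) ?_ (by simp)
    rw [← h]
    refine ⟨?_, by simpa using hu.symm⟩
    by_cases huj : u = j
    · exact huj ▸ hedge
    · exact hK.insert_mem hext (by simpa using Ne.symm huj) (isSimplex_singleton K u)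
  obtain ⟨v, rfl⟩ := hsurj j hij.symm
  let e : Option W ≃ V := Equiv.ofBijective (fun o => o.elim i f) (by
    constructor
    · rintro (_ | u) (_ | w) h
      · rfl
      · exact absurd h.symm (hfi w)
      · exact absurd h (hfi u)
      · exact congrArg some (f.injective h)
    · intro u
      by_cases hu : u = i
      · exact ⟨none, hu.symm⟩
      · obtain ⟨w, hw⟩ := hsurj u hu
        exact ⟨some w, hw⟩)
  have hLiff : ∀ t : Finset W, IsSimplex L t ↔ IsSimplex K (insert i (t.map f)) := fun t => by
    change t ∈ simplices L ↔ _
    rw [← map_mem_famMap f, ← h]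
    refine (and_iff_left ?_).trans ?_
    · rw [Finset.disjoint_singleton_left, Finset.mem_map]
      rintro ⟨w, -, hw⟩
      exact hfi w hw
    · rw [← Finset.insert_eq]
      rfl
  exact ⟨W, L, v, e, hL, isIso_wedge e v hLiff (hK.isSimplex_iff_of_extends hext)⟩

/-- An edge `{i, j}` would exhibit the seed as a wedge. Without that edge, the wedge-like formula
collapses to a suspension with poles `i` and `j`. -/
theorem IsSeed.isSimplex_iff_of_extends {V : Type} {K : AbstractSimplicialComplex V}
    (hK : IsSeed K) {i j : V} (hij : i ≠ j)
    (hext : ∀ s, IsSimplex K s → ∃ t, IsSimplex K t ∧ s ⊆ t ∧ (i ∈ t ∨ j ∈ t)) (s : Finset V) :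
    IsSimplex K s ↔ IsSimplex K ((s.erase i).erase j) ∧ ¬ (i ∈ s ∧ j ∈ s) := by
  have hedge : ¬ IsSimplex K {i, j} := fun h => hK.2 (hK.1.exists_isIso_wedge hij hext h)
  have hno : ¬ IsSimplex K (insert i (insert j ((s.erase i).erase j))) := fun h =>
    hedge (isSimplex_mono h fun x hx => by
      simp only [Finset.mem_insert, Finset.mem_singleton] at hx ⊢
      tauto)
  rw [hK.1.isSimplex_iff_of_extends hext, or_iff_right hno, and_comm (a := j ∈ s)]
  refine and_congr_left fun _ => ⟨fun h => isSimplex_mono h (Finset.subset_insert _ _), fun h => ?_⟩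
  exact hK.1.insert_mem hext (by simp) h

/-! ### The `J`-construction along a map of vertices -/

/-- The vertices of `V` whose copies, the elements of the fibre of `π`, all lie in `s`. -/
def fullFibers {U V : Type} [Fintype V] (π : U → V) (s : Finset U) : Finset V :=
  Finset.univ.filter fun i => ∀ u, π u = i → u ∈ s

/-- `L` arises from `K` by replacing each vertex by its copies, the elements of its fibre
under `π`. -/
def IsInflation {U V : Type} [Fintype V] (K : AbstractSimplicialComplex V) (π : U → V)
    (L : AbstractSimplicialComplex U) : Prop :=
  Function.Surjective π ∧ ∀ s, IsSimplex L s ↔ IsSimplex K (fullFibers π s)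

theorem mem_fullFibers {U V : Type} [Fintype V] {π : U → V} {s : Finset U} {i : V} :
    i ∈ fullFibers π s ↔ ∀ u, π u = i → u ∈ s := by
  simp [fullFibers]

theorem isSimplex_jConstruction {V : Type} [Fintype V] (K : AbstractSimplicialComplex V)
    (J : V → ℕ+) (s : Finset (Σ i : V, Fin (J i))) :
    IsSimplex (jConstruction K J) s ↔ IsSimplex K (fullFibers Sigma.fst s) := by
  have h : ∀ s : Finset (Σ i : V, Fin (J i)),
      (Finset.univ.filter fun i => ∀ k : Fin (J i), (⟨i, k⟩ : Σ i : V, Fin (J i)) ∈ s) =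
        fullFibers Sigma.fst s := by
    intro s
    ext i
    rw [mem_fullFibers]
    simp only [Finset.mem_filter, Finset.mem_univ, true_and]
    constructor
    · rintro h ⟨j, k⟩ rfl
      exact h k
    · exact fun h k => h _ rfl
  refine (isSimplex_ofFamily ?_ s).trans ?_
  · rw [Set.mem_ofPred_eq, h]
    left
    rw [Finset.eq_empty_iff_forall_notMem]
    intro i hi
    exact absurd (mem_fullFibers.mp hi ⟨i, ⟨0, (J i).pos⟩⟩ rfl) (by simp)
  · rw [Set.mem_ofPred_eq, h]

theorem fullFibers_map {U U' V : Type} [Fintype V] (e : U ≃ U') (π : U → V) (s : Finset U) :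
    fullFibers (π ∘ e.symm) (s.map e.toEmbedding) = fullFibers π s := by
  ext i
  simp only [mem_fullFibers, Finset.mem_map_equiv, Function.comp_apply]
  exact ⟨fun h u hu => by simpa using h (e u) (by simpa using hu), fun h u hu => h _ hu⟩

theorem IsInflation.of_isIso {U U' V : Type} [Fintype V] {K : AbstractSimplicialComplex V}
    {π : U → V} {L : AbstractSimplicialComplex U} {L' : AbstractSimplicialComplex U'}
    (h : IsInflation K π L) {e : U ≃ U'} (he : IsIso L L' e) : IsInflation K (π ∘ e.symm) L' := by
  refine ⟨h.1.comp e.symm.surjective, fun s => ?_⟩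
  obtain ⟨t, rfl⟩ := exists_map_eq e.toEmbedding s fun x _ => ⟨e.symm x, e.apply_symm_apply x⟩
  rw [← he t, h.2, fullFibers_map]

/-- The tuple `J` only records the fibre sizes of a surjection; working with the surjection itself
makes it easy to move or delete copies. -/
theorem mem_pairsOver_iff {V : Type} [Fintype V] (K : AbstractSimplicialComplex V)
    (X : CharPair) : X ∈ pairsOver K ↔ ∃ π : X.V → V, IsInflation K π X.L := by
  constructor
  · rintro ⟨J, e, he⟩
    refine ⟨Sigma.fst ∘ e.symm, IsInflation.of_isIso ⟨fun i => ?_, isSimplex_jConstruction K J⟩ he⟩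
    exact ⟨⟨i, ⟨0, (J i).pos⟩⟩, rfl⟩
  · rintro ⟨π, hπ, h⟩
    have hpos : ∀ i, 0 < Fintype.card {u // π u = i} := fun i => by
      obtain ⟨u, hu⟩ := hπ i
      exact Fintype.card_pos_iff.mpr ⟨⟨u, hu⟩⟩
    let J : V → ℕ+ := fun i => ⟨_, hpos i⟩
    let e : (Σ i : V, Fin (J i)) ≃ X.V :=
      (Equiv.sigmaCongrRight fun i => (Fintype.equivFin {u // π u = i}).symm).trans
        (Equiv.sigmaFiberEquiv π)
    have he : π ∘ e = Sigma.fst := by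
      funext x
      exact ((Fintype.equivFin {u // π u = x.1}).symm x.2).2
    refine ⟨J, e, fun s => ?_⟩
    rw [isSimplex_jConstruction, h, ← he, ← fullFibers_map e]
    simp [Function.comp_assoc]

theorem fullFibers_mono {U V : Type} [Fintype V] {π : U → V} {s t : Finset U}
    (h : ∀ u, u ∈ s → (∀ u', π u' = π u → u' ∈ s) → u ∈ t) : fullFibers π s ⊆ fullFibers π t := by
  intro i hi
  rw [mem_fullFibers] at hi ⊢
  rintro u rfl
  exact h u (hi u rfl) hi

/-- Merging: when `i` and `j` are suspended in `K`, the copies of `i` and `j` may be redistributed.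
So two vertices over `i` and `j` can be taken over the same vertex, or are suspended. -/
theorem IsInflation.isSuspendedPair_or_exists {U V : Type} [Fintype V]
    {K : AbstractSimplicialComplex V} {π : U → V} {L : AbstractSimplicialComplex U}
    (h : IsInflation K π L) {v w : U} (hvw : π v ≠ π w)
    (hK : ∀ s, IsSimplex K s ↔
      IsSimplex K ((s.erase (π v)).erase (π w)) ∧ ¬ (π v ∈ s ∧ π w ∈ s)) :
    IsSuspendedPair L v w ∨ ∃ π' : U → V, IsInflation K π' L ∧ π' v = π' w := by
  have hne : v ≠ w := fun h => hvw (congrArg π h)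
  by_cases hx : ∃ x, x ≠ v ∧ x ≠ w ∧ (π x = π v ∨ π x = π w)
  · right
    obtain ⟨x, hxv, hxw, hx⟩ := hx
    -- All copies of both poles go over `π v` except `x`, which keeps the fibre over `π w` nonempty.
    -- Since `K` is a suspension, only the union of these two fibres matters for `L`, and it is
    -- unchanged.
    let π' : U → V := fun u => if u = x then π w else if π u = π w then π v else π u
    have hπ' : ∀ u, (π' u = π v ∨ π' u = π w) ↔ (π u = π v ∨ π u = π w) := by
      intro u
      by_cases h₁ : u = x
      · subst h₁
        simp [π', hx]
      · by_cases h₂ : π u = π w <;> simp [π', h₁, h₂]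
    have hother : ∀ u j, j ≠ π v → j ≠ π w → (π' u = j ↔ π u = j) := by
      intro u j hjv hjw
      by_cases hu : π u = π v ∨ π u = π w
      · refine iff_of_false (fun hj => ?_) (fun hj => ?_)
        · exact ((hπ' u).mpr hu).elim (fun h => hjv (hj ▸ h)) (fun h => hjw (hj ▸ h))
        · exact hu.elim (fun h => hjv (hj ▸ h)) (fun h => hjw (hj ▸ h))
      · have h₁ : u ≠ x := fun h => hu (h ▸ hx)
        have h₂ : π u ≠ π w := fun h => hu (Or.inr h)
        simp [π', h₁, h₂]
    have hv : π' v = π v := by simp [π', hxv.symm, hvw]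
    have hw : π' w = π v := by simp [π', hxw.symm]
    refine ⟨π', ⟨fun j => ?_, fun s => ?_⟩, hv.trans hw.symm⟩
    · by_cases hjv : j = π v
      · exact ⟨v, hv.trans hjv.symm⟩
      by_cases hjw : j = π w
      · exact ⟨x, by simp [π', hjw]⟩
      obtain ⟨u, hu⟩ := h.1 j
      exact ⟨u, (hother u j hjv hjw).mpr hu⟩
    · have hboth : (π v ∈ fullFibers π' s ∧ π w ∈ fullFibers π' s) ↔
          (π v ∈ fullFibers π s ∧ π w ∈ fullFibers π s) := by
        have : ∀ ρ : U → V, (π v ∈ fullFibers ρ s ∧ π w ∈ fullFibers ρ s) ↔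
            ∀ u, (ρ u = π v ∨ ρ u = π w) → u ∈ s := fun ρ => by
          rw [mem_fullFibers, mem_fullFibers]
          exact ⟨fun h u hu => hu.elim (h.1 u) (h.2 u),
            fun h => ⟨fun u hu => h u (Or.inl hu), fun u hu => h u (Or.inr hu)⟩⟩
        rw [this, this]
        simp only [hπ']
      have herase : ((fullFibers π' s).erase (π v)).erase (π w) =
          ((fullFibers π s).erase (π v)).erase (π w) := by
        ext j
        simp only [Finset.mem_erase, mem_fullFibers]
        refine and_congr_right fun hjw => and_congr_right fun hjv => ?_
        simp only [hother _ j hjv hjw]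
      rw [h.2, hK (fullFibers π s), hK (fullFibers π' s), hboth, herase]
  · left
    push Not at hx
    have hfib : ∀ u, (π u = π v ↔ u = v) ∧ (π u = π w ↔ u = w) := by
      intro u
      by_cases huv : u = v
      · subst huv
        simp [hvw, hne]
      by_cases huw : u = w
      · subst huw
        simp [hvw.symm, hne.symm]
      · simpa [huv, huw] using hx u huv huw
    have hL : ∀ s, IsSimplex L s ↔ ¬ (v ∈ s ∧ w ∈ s) ∧ IsSimplex L ((s.erase v).erase w) := by
      intro s
      have h₁ : fullFibers π ((s.erase v).erase w) =
          ((fullFibers π s).erase (π v)).erase (π w) := by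
        ext j
        simp only [mem_fullFibers, Finset.mem_erase]
        constructor
        · intro hj
          exact ⟨fun hjw => (hj w hjw.symm).1 rfl, fun hjv => (hj v hjv.symm).2.1 rfl,
            fun u hu => (hj u hu).2.2⟩
        · rintro ⟨hjw, hjv, hj⟩ u hu
          exact ⟨fun huw => hjw (by rw [← hu, huw]), fun huv => hjv (by rw [← hu, huv]), hj u hu⟩
      rw [h.2, hK, h.2, h₁, and_comm]
      simp [mem_fullFibers, hfib]
    let f : {u : U // u ≠ v ∧ u ≠ w} ↪ U := Function.Embedding.subtype _
    have hf : ∀ s : Finset U, (s.subtype fun u => u ≠ v ∧ u ≠ w).map f = (s.erase v).erase w := by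
      intro s
      ext u
      simp only [f, Finset.mem_map, Finset.mem_subtype, Function.Embedding.coe_subtype,
        Finset.mem_erase]
      constructor
      · rintro ⟨u, hu, rfl⟩
        exact ⟨u.2.2, u.2.1, hu⟩
      · exact fun hu => ⟨⟨u, hu.2.1, hu.1⟩, hu.2.2, rfl⟩
    refine ⟨hne, ofFamily {t | IsSimplex L (t.map f)}
      (fun s hs t hts => isSimplex_mono hs (Finset.map_subset_map.mpr hts))
      (fun u => by simpa using isSimplex_singleton L (f u)), fun s => ?_⟩
    rw [isSimplex_ofFamily (Or.inl (by simp)), hL s, ← hf s]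
    rfl

/-! ### Linear algebra -/

theorem exists_isDual {V : Type} [Fintype V] {n : ℕ} (lam : V → Fin n → ZMod 2) :
    ∃ (p : ℕ) (mu : V → Fin p → ZMod 2), IsDual lam mu := by
  let N := LinearMap.ker (Fintype.linearCombination (ZMod 2) lam)
  let b := Module.finBasis (ZMod 2) N
  refine ⟨_, fun v j => (b j : V → ZMod 2) v, ?_, ?_⟩
  · exact b.linearIndependent.map' N.subtype N.ker_subtype
  · have h : (Set.range fun j => (fun v => (b j : V → ZMod 2) v)) = N.subtype '' Set.range b := by
      rw [← Set.range_comp]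
      rfl
    rw [h, ← Submodule.map_span, b.span_eq, Submodule.map_top, Submodule.range_subtype]

/-- Equal rows of a dual map yield a functional that singles out the two vertices. -/
theorem IsDual.exists_functional {V : Type} [Fintype V] {n p : ℕ} {lam : V → Fin n → ZMod 2}
    {mu : V → Fin p → ZMod 2} (h : IsDual lam mu) {v w : V} (hvw : v ≠ w) (hmu : mu v = mu w) :
    ∃ f : (Fin n → ZMod 2) →ₗ[ZMod 2] ZMod 2,
      f (lam v) = 1 ∧ f (lam w) = 1 ∧ ∀ u, u ≠ v → u ≠ w → f (lam u) = 0 := by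
  -- The sum of the two coordinates vanishes on the columns of `mu`, as the rows at `v` and `w`
  -- agree in characteristic 2. Those columns span the kernel, so `g` lies in the range of the dual
  -- of `lam`.
  let g : (V → ZMod 2) →ₗ[ZMod 2] ZMod 2 :=
    (LinearMap.proj v : (V → ZMod 2) →ₗ[ZMod 2] ZMod 2) + LinearMap.proj w
  have hg : g ∈ (LinearMap.ker (Fintype.linearCombination (ZMod 2) lam)).dualAnnihilator := by
    rw [Submodule.mem_dualAnnihilator, ← h.2]
    intro x hx
    induction hx using Submodule.span_induction with
    | mem x hx =>
      obtain ⟨j, rfl⟩ := hx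
      change mu v j + mu w j = 0
      rw [hmu]
      exact CharTwo.add_self_eq_zero _
    | zero => exact map_zero g
    | add x y _ _ hx hy => rw [map_add, hx, hy, add_zero]
    | smul c x _ hx => rw [map_smul, hx, smul_zero]
  rw [← LinearMap.range_dualMap_eq_dualAnnihilator_ker] at hg
  obtain ⟨f, hf⟩ := hg
  have key : ∀ u, f (lam u) = (Pi.single u 1 : V → ZMod 2) v + (Pi.single u 1 : V → ZMod 2) w := by
    intro u
    have := LinearMap.congr_fun hf (Pi.single u 1)
    rw [LinearMap.dualMap_apply, Fintype.linearCombination_apply_single, one_smul] at this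
    exact this
  refine ⟨f, ?_, ?_, fun u huv huw => ?_⟩
  · rw [key]; simp [hvw.symm]
  · rw [key]; simp [hvw]
  · rw [key]; simp [huv.symm, huw.symm]

/-- A characteristic map admitting a functional that singles out `v` and the new vertex of the wedge
at `v` is the canonical extension of its projection. -/
theorem isWedgeMap_of_functional {W : Type} {n k : ℕ} (v : W) (Lam : Option W → Fin k → ZMod 2)
    (f : (Fin k → ZMod 2) →ₗ[ZMod 2] ZMod 2) (hv : f (Lam (some v)) = 1) (hn : f (Lam none) = 1)
    (hf : ∀ u, u ≠ v → f (Lam (some u)) = 0)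
    (φ : ((Fin k → ZMod 2) ⧸ Submodule.span (ZMod 2) {Lam none}) ≃ₗ[ZMod 2] (Fin n → ZMod 2)) :
    IsWedgeMap v (fun u => φ (proj Lam none (some u))) (fun u => φ (proj Lam none (some u)))
      Lam := by
  refine ⟨?_, φ, fun u => rfl⟩
  have hself : ∀ x : Fin k → ZMod 2, x + x = 0 := fun x =>
    funext fun i => CharTwo.add_self_eq_zero (x i)
  have hadd : ∀ x y : Fin k → ZMod 2, x + (x + y) = y := fun x y => by
    rw [← add_assoc, hself, zero_add]
  -- A transvection: it swaps `Lam none` and `Lam (some v)` and fixes the values where `f` vanishes.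
  -- It is an involution because `f` is zero on the sum of the two swapped vectors.
  let T₀ : (Fin k → ZMod 2) →ₗ[ZMod 2] (Fin k → ZMod 2) :=
    LinearMap.id + f.smulRight (Lam none + Lam (some v))
  have hT₀ : ∀ x, T₀ x = x + f x • (Lam none + Lam (some v)) := fun x => rfl
  have hT₁ : ∀ x, f x = 0 → T₀ x = x := fun x hx => by rw [hT₀, hx, zero_smul, add_zero]
  have hTn : T₀ (Lam none) = Lam (some v) := by rw [hT₀, hn, one_smul, hadd]
  have hTv : T₀ (Lam (some v)) = Lam none := by
    rw [hT₀, hv, one_smul, add_comm (Lam none), hadd]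
  have hinv : Function.Involutive T₀ := fun x => by
    have h : f (T₀ x) = f x := by
      rw [hT₀, map_add, map_smul, map_add, hn, hv, CharTwo.add_self_eq_zero, smul_zero, add_zero]
    rw [hT₀ (T₀ x), h, hT₀, add_assoc, hself, add_zero]
  let T := LinearEquiv.ofInvolutive T₀ hinv
  have hspan : (Submodule.span (ZMod 2) {Lam (some v)}).map
      (T : (Fin k → ZMod 2) →ₗ[ZMod 2] (Fin k → ZMod 2)) = Submodule.span (ZMod 2) {Lam none} := by
    rw [Submodule.map_span, Set.image_singleton]
    exact congrArg (fun x => Submodule.span (ZMod 2) {x}) hTv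
  refine ⟨(Submodule.Quotient.equiv _ _ T hspan).trans φ, fun u => congrArg φ ?_⟩
  by_cases hu : u = v
  · subst hu
    simp only [if_true]
    exact congrArg Submodule.Quotient.mk hTn
  · simp only [if_neg hu]
    exact congrArg Submodule.Quotient.mk (hT₁ _ (hf u hu))

/-- A functional vanishing on a simplex of maximal size vanishes on all vertices. -/
theorem IsCharMap.functional_eq_zero {V : Type} {n : ℕ} {L : AbstractSimplicialComplex V}
    {lam : V → Fin n → ZMod 2} (h : IsCharMap L lam) {s : Finset V} (hs : IsSimplex L s)
    (hn : n ≤ s.card) (f : (Fin n → ZMod 2) →ₗ[ZMod 2] ZMod 2) (hf : ∀ u ∈ s, f (lam u) = 0) :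
    f = 0 := by
  have hcard : s.card = n := le_antisymm (h.1.2 ⟨s, hs, rfl⟩) hn
  have hspan := LinearIndependent.span_eq_top_of_card_eq_finrank' (h.2 s hs) (by simp [hcard])
  refine LinearMap.ext_on_range hspan fun u => ?_
  simpa using hf u u.2

/-! ### Maximal simplices of inflations -/

/-- Take all vertices except the chosen copy `c j` of each `j ∉ t`; the full fibres are exactly
those over `t`. Any simplex of `L` misses a vertex in each non-full fibre, and purity gives at least
as many of these, so none is larger. -/
theorem IsInflation.exists_simplex_of_section {U V : Type} [Fintype U] [Fintype V]
    {K : AbstractSimplicialComplex V} {π : U → V} {L : AbstractSimplicialComplex U}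
    (h : IsInflation K π L) {k : ℕ} (hK : IsPure (simplices K) k) {n : ℕ} (hn : HasDimSubOne L n)
    {c : V → U} (hc : ∀ j, π (c j) = j) {t : Finset V} (ht : IsSimplex K t) (htk : t.card = k) :
    ∃ s, IsSimplex L s ∧ n ≤ s.card ∧ ∀ j, j ∉ t → c j ∉ s := by
  let G : Finset U := Finset.univ.filter fun u => π u ∈ t ∨ u ≠ c (π u)
  have hG : fullFibers π G = t := by
    ext j
    rw [mem_fullFibers]
    constructor
    · intro hj
      simpa [G, hc] using hj (c j) (hc j)
    · rintro hj u rfl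
      simp [G, hj]
  refine ⟨G, (h.2 G).mpr (hG ▸ ht), ?_, fun j hj => by simp [G, hc, hj]⟩
  obtain ⟨s, hs, rfl⟩ := hn.1
  have h₁ : (fullFibers π s).card ≤ t.card := htk ▸ (hK _ ((h.2 s).mp hs)).1
  have h₂ : (fullFibers π s)ᶜ ⊆ sᶜ.image π := fun j hj => by
    rw [Finset.mem_compl, mem_fullFibers] at hj
    push Not at hj
    obtain ⟨u, hu, hus⟩ := hj
    exact Finset.mem_image.mpr ⟨u, Finset.mem_compl.mpr hus, hu⟩
  have h₃ : Gᶜ ⊆ tᶜ.image c := fun u hu => by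
    simp only [G, Finset.mem_compl, Finset.mem_filter, Finset.mem_univ, true_and, not_or,
      not_not] at hu
    exact Finset.mem_image.mpr ⟨π u, Finset.mem_compl.mpr hu.1, hu.2.symm⟩
  have h₄ := (Finset.card_le_card h₂).trans Finset.card_image_le
  have h₅ := (Finset.card_le_card h₃).trans Finset.card_image_le
  have h₆ := Finset.card_le_univ G
  have h₇ := Finset.card_le_univ s
  have h₈ := Finset.card_le_univ t
  have h₉ := Finset.card_le_univ (fullFibers π s)
  simp only [Finset.card_compl] at h₄ h₅
  omega

/-- A functional that singles out `v` and `w` forces every maximal simplex of `K` to contain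
`π v` or `π w`. -/
theorem IsInflation.exists_extension {U V : Type} [Fintype U] [Fintype V]
    {K : AbstractSimplicialComplex V} {π : U → V} {L : AbstractSimplicialComplex U}
    (h : IsInflation K π L) {k : ℕ} (hK : IsPure (simplices K) k) {n : ℕ}
    {lam : U → Fin n → ZMod 2} (hlam : IsCharMap L lam) {v w : U} (hvw : π v ≠ π w)
    (f : (Fin n → ZMod 2) →ₗ[ZMod 2] ZMod 2) (hv : f (lam v) = 1)
    (hf : ∀ u, u ≠ v → u ≠ w → f (lam u) = 0) (s : Finset V) (hs : IsSimplex K s) :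
    ∃ t, IsSimplex K t ∧ s ⊆ t ∧ (π v ∈ t ∨ π w ∈ t) := by
  obtain ⟨-, t, ht, hst, htk⟩ := hK s hs
  refine ⟨t, ht, hst, ?_⟩
  by_contra! hcon
  choose c₀ hc₀ using h.1
  -- The section passes through `v` and `w`, so a facet missing `π v` and `π w` lifts to one missing
  -- `v` and `w`, where `f` is identically zero.
  let c : V → U := Function.update (Function.update c₀ (π v) v) (π w) w
  have hcw : c (π w) = w := by simp [c]
  have hcv : c (π v) = v := by simp [c, hvw]
  have hc : ∀ j, π (c j) = j := by
    intro j
    by_cases hjw : j = π w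
    · rw [hjw, hcw]
    by_cases hjv : j = π v
    · rw [hjv, hcv]
    simp [c, hjw, hjv, hc₀]
  obtain ⟨G, hG, hn, hcG⟩ := h.exists_simplex_of_section hK hlam.1 hc ht htk
  have hvG := hcG _ hcon.1
  have hwG := hcG _ hcon.2
  rw [hcv] at hvG
  rw [hcw] at hwG
  have := hlam.functional_eq_zero hG hn f fun u hu =>
    hf u (fun h => hvG (h ▸ hu)) (fun h => hwG (h ▸ hu))
  rw [this] at hv
  simp at hv

/-! ### Descent -/

/-- Two vertices over the same vertex of `K` make `L` a wedge. -/
theorem IsInflation.isSimplex_iff_of_eq {U V : Type} [Fintype V]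
    {K : AbstractSimplicialComplex V} {π : U → V} {L : AbstractSimplicialComplex U}
    (h : IsInflation K π L) {v w : U} (hne : v ≠ w) (hvw : π v = π w) (s : Finset U) :
    IsSimplex L s ↔ IsSimplex L (insert w (insert v ((s.erase w).erase v))) ∨
      (IsSimplex L (insert w ((s.erase w).erase v)) ∧ ¬ (v ∈ s ∧ w ∈ s)) := by
  have hsub : insert w ((s.erase w).erase v) ⊆ insert w (insert v ((s.erase w).erase v)) :=
    Finset.insert_subset_insert _ (Finset.subset_insert _ _)
  by_cases hb : v ∈ s ∧ w ∈ s
  · have : insert w (insert v ((s.erase w).erase v)) = s := by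
      ext u
      simp only [Finset.mem_insert, Finset.mem_erase]
      have h₁ := hb.1
      have h₂ := hb.2
      by_cases huv : u = v
      · simp [huv, h₁]
      · by_cases huw : u = w
        · simp [huw, h₂]
        · simp [huv, huw]
    simp [this, hb]
  -- A set lacking `v` or `w` does not contain their common fibre, so which of the two it contains
  -- cannot affect whether it is a simplex.
  · have heq : IsSimplex L (insert w ((s.erase w).erase v)) → IsSimplex L s := by
      rw [h.2, h.2]
      refine fun hs => isSimplex_mono hs (fullFibers_mono fun u hu hfib => ?_)
      have huv : u ≠ v := fun huv => hb ⟨huv ▸ hu, hfib w (by rw [huv, hvw])⟩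
      simp only [Finset.mem_insert, Finset.mem_erase]
      tauto
    constructor
    · intro hs
      refine Or.inr ⟨?_, hb⟩
      rw [h.2] at hs ⊢
      refine isSimplex_mono hs (fullFibers_mono fun u hu hfib => ?_)
      have huw : u ≠ w := fun huw => by
        have := hfib v (by rw [huw, hvw])
        simp [hne] at this
      simp only [Finset.mem_insert, Finset.mem_erase] at hu
      tauto
    · rintro (hs | hs)
      · exact heq (isSimplex_mono hs hsub)
      · exact heq hs.1

/-- A characteristic map with a functional that singles out two vertices over the same vertex of
`K` is a canonical extension of one on fewer vertices. -/
theorem exists_isCanonicalExtension {V : Type} [Fintype V] {K : AbstractSimplicialComplex V}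
    (X : CharPair) {π : X.V → V} (h : IsInflation K π X.L) {v w : X.V} (hne : v ≠ w)
    (hvw : π v = π w) (f : (Fin X.n → ZMod 2) →ₗ[ZMod 2] ZMod 2) (hv : f (X.lam v) = 1)
    (hw : f (X.lam w) = 1) (hf : ∀ u, u ≠ v → u ≠ w → f (X.lam u) = 0) :
    ∃ Y ∈ pairsOver K, Fintype.card Y.V < Fintype.card X.V ∧
      ∃ v', IsCanonicalExtension Y v' X := by
  let ι : {u // u ≠ w} ↪ X.V := Function.Embedding.subtype _
  let e : Option {u // u ≠ w} ≃ X.V := Equiv.ofBijective (fun o => o.elim w ι) (by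
    constructor
    · rintro (_ | a) (_ | b) hab
      · rfl
      · exact absurd hab.symm b.2
      · exact absurd hab a.2
      · exact congrArg some (ι.injective hab)
    · intro u
      by_cases hu : u = w
      · exact ⟨none, hu.symm⟩
      · exact ⟨some ⟨u, hu⟩, rfl⟩)
  have hιw : ∀ t : Finset {u // u ≠ w}, w ∉ t.map ι := fun t ht => by
    obtain ⟨u, -, hu⟩ := Finset.mem_map.mp ht
    exact u.2 hu
  have hsingle : ∀ u : {u // u ≠ w}, IsSimplex X.L (insert w (({u} : Finset _).map ι)) := by
    intro u
    rw [h.2]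
    refine isSimplex_mono (isSimplex_singleton K (π u)) fun j hj => ?_
    rw [mem_fullFibers] at hj
    rw [Finset.mem_singleton]
    have hcase : ∀ x, π x = j → x ≠ w → j = π u := fun x hx hxw => by
      have := hj x hx
      simp only [Finset.map_singleton, Finset.mem_insert, Finset.mem_singleton] at this
      rw [← hx, this.resolve_left hxw]
      rfl
    obtain ⟨x, hx⟩ := h.1 j
    by_cases hxw : x = w
    · exact hcase v (by rw [hvw, ← hxw, hx]) hne
    · exact hcase x hx hxw
  -- The smaller complex is the link of `w`. By `hsingle` all other vertices lie in it, and by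
  -- `hinf` it is the inflation of `K` with the copy `w` removed.
  let L' : AbstractSimplicialComplex {u // u ≠ w} :=
    ofFamily {t | IsSimplex X.L (insert w (t.map ι))}
      (fun s hs t hts => isSimplex_mono hs
        (Finset.insert_subset_insert _ (Finset.map_subset_map.mpr hts)))
      hsingle
  have hL' : ∀ t, IsSimplex L' t ↔ IsSimplex X.L (insert w (t.map ι)) := by
    refine isSimplex_ofFamily ?_
    exact isSimplex_mono (isSimplex_singleton X.L w) (by simp)
  have hinf : IsInflation K (π ∘ ι) L' := by
    refine ⟨fun j => ?_, fun t => ?_⟩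
    · obtain ⟨u, rfl⟩ := h.1 j
      by_cases hu : u = w
      · exact ⟨⟨v, hne⟩, by rw [hu]; exact hvw⟩
      · exact ⟨⟨u, hu⟩, rfl⟩
    · rw [hL', h.2]
      refine iff_of_eq (congrArg (IsSimplex K) ?_)
      ext j
      simp only [mem_fullFibers, Finset.mem_insert]
      constructor
      · intro hj u hu
        exact (Finset.mem_map' ι).mp ((hj (ι u) hu).resolve_left u.2)
      · intro hj u hu
        by_cases huw : u = w
        · exact Or.inl huw
        · exact Or.inr ((Finset.mem_map' ι).mpr (hj ⟨u, huw⟩ hu))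
  let Lam : Option {u // u ≠ w} → Fin X.n → ZMod 2 := fun o => X.lam (e o)
  have hLam : Lam none = X.lam w := rfl
  let Q := (Fin X.n → ZMod 2) ⧸ Submodule.span (ZMod 2) {Lam none}
  let φ : Q ≃ₗ[ZMod 2] (Fin (Module.finrank (ZMod 2) Q) → ZMod 2) :=
    (Module.finBasis (ZMod 2) Q).equivFun
  have hrank : Module.finrank (ZMod 2) Q + 1 = X.n := by
    have hne : Lam none ≠ 0 := fun h0 => by
      rw [← hLam, h0, map_zero] at hw
      exact zero_ne_one hw
    have h₁ := Submodule.finrank_quotient_add_finrank (Submodule.span (ZMod 2) {Lam none})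
    rw [finrank_span_singleton hne, Module.finrank_fin_fun] at h₁
    exact h₁
  let lam' : {u // u ≠ w} → Fin (Module.finrank (ZMod 2) Q) → ZMod 2 :=
    fun u => φ (proj Lam none (some u))
  have hcard : ∀ t : Finset {u // u ≠ w}, (insert w (t.map ι)).card = t.card + 1 := fun t => by
    rw [Finset.card_insert_of_notMem (hιw t), Finset.card_map]
  have hchar : IsCharMap L' lam' := by
    refine ⟨⟨?_, ?_⟩, fun t ht => ?_⟩
    · obtain ⟨s, hs, hsn⟩ := X.isCharMap.1.1
      obtain ⟨t, ht, hwt, htn⟩ : ∃ t, IsSimplex X.L t ∧ w ∈ t ∧ X.n ≤ t.card := by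
        by_cases hws : w ∈ s
        · exact ⟨s, hs, hws, hsn.ge⟩
        -- Trading `v` for `w` creates no full fibre and loses no vertices, so some largest simplex
        -- contains `w` and the link has dimension exactly one less.
        · refine ⟨insert w (s.erase v), ?_, by simp, ?_⟩
          · rw [h.2] at hs ⊢
            refine isSimplex_mono hs (fullFibers_mono fun u hu hfib => ?_)
            have huw : u ≠ w := fun huw => by
              have := hfib v (by rw [hvw, huw])
              simp [hne] at this
            simp only [Finset.mem_insert, Finset.mem_erase] at hu
            tauto
          · rw [Finset.card_insert_of_notMem (by simp [hws]), ← hsn]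
            have := Finset.pred_card_le_card_erase (s := s) (a := v)
            omega
      obtain ⟨t', ht'⟩ := exists_map_eq ι (t.erase w) fun x hx =>
        ⟨⟨x, (Finset.mem_erase.mp hx).1⟩, rfl⟩
      have ht'' : insert w (t'.map ι) = t := by rw [ht', Finset.insert_erase hwt]
      refine ⟨t', (hL' t').mpr (ht''.symm ▸ ht), ?_⟩
      have h₁ := hcard t'
      have h₂ := X.isCharMap.1.2 ⟨t, ht, rfl⟩
      rw [ht''] at h₁
      omega
    · rintro _ ⟨t, ht, rfl⟩
      have h₁ := X.isCharMap.1.2 ⟨_, (hL' t).mp ht, rfl⟩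
      rw [hcard t] at h₁
      omega
    · have h₁ := X.isCharMap.2 _ ((hL' t).mp ht)
      have h₂ : ((insert w (t.map ι) : Finset X.V) : Set X.V) = {w} ∪ ι '' t := by
        rw [Finset.coe_insert, Finset.coe_map, Set.insert_eq]
      -- Independence of a simplex containing `w` amounts to independence of the value at `w`
      -- together with independence of the rest modulo that value.
      rw [h₂, linearIndepOn_union_iff_quotient] at h₁
      · have h₃ := h₁.2
        rw [Set.image_singleton, ← hLam] at h₃
        exact (h₃.comp_of_image ι.injective.injOn).map_injOn φ.toLinearMap φ.injective.injOn
      · rw [Set.disjoint_singleton_left]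
        rintro ⟨u, -, hu⟩
        exact u.2 hu
  let v' : {u // u ≠ w} := ⟨v, hne⟩
  have hwedge : IsWedgeMap v' lam' lam' Lam := by
    have hv' : f (Lam (some v')) = 1 := hv
    have hw' : f (Lam none) = 1 := hw
    have hf' : ∀ u : {u // u ≠ w}, u ≠ v' → f (Lam (some u)) = 0 := fun u hu =>
      hf u (fun h => hu (Subtype.ext h)) u.2
    exact isWedgeMap_of_functional v' Lam f hv' hw' hf' φ
  let Y : CharPair := ⟨{u // u ≠ w}, L', _, lam', hchar⟩
  refine ⟨Y, (mem_pairsOver_iff K Y).mpr ⟨_, hinf⟩, ?_, v', e, ?_, hwedge⟩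
  · exact Fintype.card_subtype_lt (x := w) (by simp)
  · exact isIso_wedge e v' hL' (h.isSimplex_iff_of_eq hne hvw)

/-- Over a seed, vertices with equal dual values that are not suspended can be taken over the same
vertex of the seed. -/
theorem IsSeed.exists_isInflation_eq {V : Type} [Fintype V] {K : AbstractSimplicialComplex V}
    (hK : IsSeed K) {X : CharPair} (hX : X ∈ pairsOver K) {v w : X.V}
    (hsus : ¬ IsSuspendedPair X.L v w) (f : (Fin X.n → ZMod 2) →ₗ[ZMod 2] ZMod 2)
    (hv : f (X.lam v) = 1) (hf : ∀ u, u ≠ v → u ≠ w → f (X.lam u) = 0) :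
    ∃ π : X.V → V, IsInflation K π X.L ∧ π v = π w := by
  obtain ⟨π, hπ⟩ := (mem_pairsOver_iff K X).mp hX
  by_cases hvw : π v = π w
  · exact ⟨π, hπ, hvw⟩
  obtain ⟨k, hk⟩ := hK.1.exists_isPure
  exact (hπ.isSuspendedPair_or_exists hvw (hK.isSimplex_iff_of_extends hvw
    (hπ.exists_extension hk X.isCharMap hvw f hv hf))).resolve_left hsus

end ToricWedge

end

/-! ### Induction on the number of vertices -/

theorem proposition4p6 {m : ℕ} (K : AbstractSimplicialComplex (Fin m))
    (hseed : ToricWedge.IsSeed K) (hcolorable : ToricWedge.IsColorable K)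
    (P : ToricWedge.CharPair → Prop)
    (basis : ∀ X ∈ ToricWedge.pairsOver K,
      ∀ (p : ℕ) (mu : X.V → Fin p → ZMod 2), ToricWedge.IsDual X.lam mu →
        ToricWedge.IsQuasiInjective X.L mu → P X)
    (step : ∀ X ∈ ToricWedge.pairsOver K, P X →
      ∀ (v : X.V) (Y : ToricWedge.CharPair), ToricWedge.IsCanonicalExtension X v Y → P Y) :
    ∀ X ∈ ToricWedge.pairsOver K, P X := by
  intro X hX
  induction hN : Fintype.card X.V using Nat.strong_induction_on generalizing X with
  | _ N ih =>
    subst hN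
    obtain ⟨p, mu, hmu⟩ := ToricWedge.exists_isDual X.lam
    by_cases hq : ToricWedge.IsQuasiInjective X.L mu
    · exact basis X hX p mu hmu hq
    · simp only [ToricWedge.IsQuasiInjective, not_forall] at hq
      obtain ⟨v, w, hne, hvw, hsus⟩ := hq
      obtain ⟨f, hv, hw, hf⟩ := hmu.exists_functional hne hvw
      obtain ⟨π, hπ, heq⟩ := hseed.exists_isInflation_eq hX hsus f hv hf
      obtain ⟨Y, hY, hcard, v', hcan⟩ :=
        ToricWedge.exists_isCanonicalExtension X hπ hne heq f hv hw hf
      exact step Y hY (ih _ hcard Y hY rfl) v' X hcan
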